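/- Let $d\ge 1$ and let $m$ be Lebesgue measure on $\mathbb R^d$. All Lévy measures $\nu$ below are symmetric Lévy measures on $\mathbb R^d$ of infinite mass: Borel measures with $\nu(\{0\})=0$, $\int (1\wedge|y|^2)\,\nu(dy)<\infty$, $\nu(-D)=\nu(D)$ for every Borel set $D$, and $\nu(\mathbb R^d)=\infty$. For such $\nu$ put $$\Phi(\xi)=\int(1-\cos\langle\xi,y\rangle)\,\nu(dy),\quad \Psi(r)=\sup_{|\xi|\le r}\Phi(\xi),\quad \Psi^{-1}(s)=\sup\{r>0:\Psi(r)=s\},\quad h(t)=\frac1{\Psi^{-1}(1/t)},$$ and $H(r)=\int(1\wedge r^2|y|^2)\,\nu(dy)$. Let $(P_t)_{t\ge0}$ be the convolution semigroup of probability measures with $\int e^{i\langle\xi,y\rangle}P_t(dy)=e^{-t\Phi(\xi)}$ and, where it exists, let $p_t$ be the continuous density of $P_t$ with respect to $m$, $t>0$. For $M_0>0$ we say that (A1) holds with constant $M_0$ and $t_p=\infty$ if $\int_{\mathbb R^d}e^{-t\Phi(\xi)}|\xi|\,d\xi\le M_0\,h(t)^{-d-1}$ for all $t>0$. There is a constant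 $L_0=L_0(d)>0$ such that (i) $L_0H(r)\le\Psi(r)\le2H(r)$ for all $\nu$ and all $r>0$; and for every $M_0>0$ there is a constant $\theta=\theta(d,M_0)>0$ such that (ii) for some $a,b>0$ depending only on $d,M_0$ one has $a\,h(t)^{-d}\le p_t(x)\le b\,h(t)^{-d}$ whenever $|x|<\theta h(t)$, $t>0$, for all $\nu$ satisfying (A1) with constant $M_0$ and $t_p=\infty$. **Theorem.** Fix $M_0>0$ and any constants $L_0,\theta>0$ with the properties (i) and (ii), and put $\eta_0=\theta\wedge\frac{L_0}{216}\wedge1$. There are positive constants $c_1,c_2,c_3,c_4$ depending only on $d$ and $M_0$ (through the choice of $L_0$ and $\theta$ as well) such that the following holds. Let $r_0>0$, let $\nu$ satisfy (A1) with constant $M_0$ and $t_p=\infty$, let $\operatorname{supp}\nu\subset\{|x|\le r_0\}$, and suppose $$\kappa_0=\operatorname*{ess\,inf}_{0<|x|<r_0}\frac{d\nu_c}{dm}(x)>0,$$ where $\nu_c$ is the absolutely continuous part of $\nu$ with respect to $m$. Put $$m_0=\int|y|^2\,\nu(dy),\qquad t_0=\frac{4r_0^2}{\eta_0L_0m_0},\qquad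 C_*=\frac{\eta_0L_0m_0}{4r_0}.$$ Then for every $t>0$ the measure $P_t$ has a continuous density $p_t$, and $$p_t(x)\ge c_1\begin{cases}h(t)^{-d}&\text{for }|x|\le\eta_0h(t),\ t>0,\\[2pt] t\,h(t)^{-d}\,\nu(B(x,c_2h(t)))&\text{for }\eta_0h(t)\le|x|\le r_0,\ 0<t\le t_0,\\[2pt] h(t)^{-d}\exp\left\{-\dfrac{c_3|x|^2}{m_0t}\right\}&\text{for }\eta_0h(t)\le|x|\le C_*t,\ t\ge t_0,\\[4pt] r_0^{-d}\exp\left\{-\dfrac{2|x|}{r_0}\log\left(\dfrac{c_4|x|}{r_0^{d+1}\kappa_0t}\right)\right\}&\text{for }|x|\ge r_0\vee C_*t,\ t>0.\end{cases}$$ Moreover $$\sqrt{L_0m_0}\,\sqrt t\le h(t)\le\sqrt{2m_0}\,\sqrt t\qquad\text{for }t>\frac{r_0^2}{L_0m_0}.$$ -/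

import Mathlib

open MeasureTheory
open scoped ENNReal RealInnerProductSpace

noncomputable section

namespace TruncatedLevy

/-- The space `ℝ^d` with the Euclidean norm. -/
abbrev Rd (d : ℕ) : Type := EuclideanSpace ℝ (Fin d)

/-- Symmetric Lévy measures on `ℝ^d` with infinite mass. As usual a Lévy measure does not
charge the origin, i.e. it is a measure on `ℝ^d \ {0}`. -/
structure IsSymmLevyMeasure {d : ℕ} (ν : Measure (Rd d)) : Prop where
  zero : ν {0} = 0
  finite : ∫⁻ y, ENNReal.ofReal (min 1 (‖y‖ ^ 2)) ∂ν < ∞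
  symm : ∀ D : Set (Rd d), MeasurableSet D → ν ((fun y => -y) ⁻¹' D) = ν D
  infinite : ν Set.univ = ∞

variable {d : ℕ}

/-- The characteristic exponent `Φ(ξ) = ∫ (1 - cos ⟨ξ, y⟩) ν(dy)`. -/
def Phi (ν : Measure (Rd d)) (ξ : Rd d) : ℝ := ∫ y, (1 - Real.cos ⟪ξ, y⟫) ∂ν

/-- `Ψ(r) = sup_{|ξ| ≤ r} Φ(ξ)`. -/
def Psi (ν : Measure (Rd d)) (r : ℝ) : ℝ := sSup (Phi ν '' Metric.closedBall 0 r)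

/-- `H(r) = ∫ (1 ∧ r²|y|²) ν(dy)`. -/
def HFun (ν : Measure (Rd d)) (r : ℝ) : ℝ := ∫ y, min 1 (r ^ 2 * ‖y‖ ^ 2) ∂ν

/-- The generalized inverse `Ψ⁻¹(s) = sup {r > 0 : Ψ(r) = s}`. -/
def PsiInv (ν : Measure (Rd d)) (s : ℝ) : ℝ := sSup {r : ℝ | 0 < r ∧ Psi ν r = s}

/-- `h(t) = 1 / Ψ⁻¹(1/t)`. -/
def hFun (ν : Measure (Rd d)) (t : ℝ) : ℝ := 1 / PsiInv ν (1 / t)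

/-- Condition (A1) with constants `M₀` and `t_p ∈ (0, ∞]`:
`∫ e^{-tΦ(ξ)} |ξ| dξ ≤ M₀ h(t)^{-d-1}` for all `t ∈ (0, t_p)`. -/
def CondA1 (ν : Measure (Rd d)) (M₀ : ℝ) (tp : ℝ≥0∞) : Prop :=
  ∀ t : ℝ, 0 < t → ENNReal.ofReal t < tp →
    ∫⁻ ξ : Rd d, ENNReal.ofReal (Real.exp (-t * Phi ν ξ) * ‖ξ‖)
      ≤ ENNReal.ofReal (M₀ * (hFun ν t ^ (d + 1))⁻¹)

/-- `P = (P_t)_{t ≥ 0}` is the family of probability measures with Fourier transforms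
`∫ e^{i⟨ξ, y⟩} P_t(dy) = e^{-tΦ(ξ)}`; the convolution semigroup property and the uniqueness
of `P_t` for `t ≥ 0` follow from this formula. -/
def IsLevySemigroup (ν : Measure (Rd d)) (P : ℝ → Measure (Rd d)) : Prop :=
  ∀ t : ℝ, 0 ≤ t → IsProbabilityMeasure (P t) ∧
    ∀ ξ : Rd d, charFun (P t) ξ = ((Real.exp (-t * Phi ν ξ) : ℝ) : ℂ)

/-- For every `t > 0` the function `p_t` is the continuous density of `P_t` with respect to
Lebesgue measure. -/
def IsTransitionDensity (P : ℝ → Measure (Rd d)) (p : ℝ → Rd d → ℝ) : Prop :=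
  ∀ t : ℝ, 0 < t → Continuous (p t) ∧ (∀ x, 0 ≤ p t x) ∧
    P t = volume.withDensity (fun x => ENNReal.ofReal (p t x))

/-- `L₀ > 0` is a dimensional constant with `L₀ H(r) ≤ Ψ(r) ≤ 2 H(r)` for all `r > 0` and all
symmetric Lévy measures on `ℝ^d`. -/
def IsPsiConstant (d : ℕ) (L₀ : ℝ) : Prop :=
  0 < L₀ ∧ ∀ ν : Measure (Rd d), IsSymmLevyMeasure ν → ∀ r : ℝ, 0 < r →
    L₀ * HFun ν r ≤ Psi ν r ∧ Psi ν r ≤ 2 * HFun ν r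

/-- `θ > 0` is a constant for `d` and `M₀` such that `p_t(x)` is comparable with `h(t)^{-d}` for
`|x| < θ h(t)`, `t > 0`, with comparability constants depending only on `d` and `M₀`, for all
symmetric Lévy measures that satisfy (A1) with constants `M₀` and `t_p = ∞`. -/
def IsThetaConstant (d : ℕ) (M₀ θ : ℝ) : Prop :=
  0 < θ ∧ ∃ a b : ℝ, 0 < a ∧ 0 < b ∧
    ∀ ν : Measure (Rd d), IsSymmLevyMeasure ν → CondA1 ν M₀ ∞ →
    ∀ (P : ℝ → Measure (Rd d)) (p : ℝ → Rd d → ℝ),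
      IsLevySemigroup ν P → IsTransitionDensity P p →
      ∀ (t : ℝ) (x : Rd d), 0 < t → ‖x‖ < θ * hFun ν t →
        a * (hFun ν t ^ d)⁻¹ ≤ p t x ∧ p t x ≤ b * (hFun ν t ^ d)⁻¹

/-- `κ₀ = inf_{0 < |x| < r₀} (dν_c/dm)(x)`. The density `dν_c/dm` of the absolutely continuous
part `ν_c` of `ν` is defined up to Lebesgue null sets only, so this is the essential infimum.
(A Lévy measure is σ-finite, so that `ν.rnDeriv volume` is indeed the density of `ν_c`.) -/
def kappa (ν : Measure (Rd d)) (r₀ : ℝ) : ℝ≥0∞ :=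
  essInf (ν.rnDeriv volume) (volume.restrict {x : Rd d | 0 < ‖x‖ ∧ ‖x‖ < r₀})

/-- `m₀ = ∫ |y|² ν(dy)`. -/
def secondMoment (ν : Measure (Rd d)) : ℝ := ∫ y, ‖y‖ ^ 2 ∂ν

/-- `η₀ = θ ∧ (L₀/216) ∧ 1`. -/
def eta (θ L₀ : ℝ) : ℝ := min θ (min (L₀ / 216) 1)

/-- `t₀ = 4 r₀² / (η₀ L₀ m₀)`. -/
def tZero (ν : Measure (Rd d)) (θ L₀ r₀ : ℝ) : ℝ :=
  4 * r₀ ^ 2 / (eta θ L₀ * L₀ * secondMoment ν)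

/-- `C_* = η₀ L₀ m₀ / (4 r₀)`. -/
def CStar (ν : Measure (Rd d)) (θ L₀ r₀ : ℝ) : ℝ :=
  eta θ L₀ * L₀ * secondMoment ν / (4 * r₀)

end TruncatedLevy

end

noncomputable section

namespace TruncatedLevy

open Filter Topology FourierTransform

variable {d : ℕ}

/-! By symmetry of `ν` the density is `(2π)^{-d}` times the cosine transform of `e^{-tΦ}`. Every
bound comes from a splitting `ν = ν₁ + ν₂` with `ν₂` finite, or from Chapman–Kolmogorov. Expanding
`e^{t cosT ν₂}` as a power series gives the compound Poisson series: its terms are nonnegative, and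
the `k`-th describes paths with exactly `k` jumps from `ν₂`, so any single term bounds `p_t` from
below (`density_ge_jumps`).

The motion driven by `ν₁` is controlled by `core_lower_bound`. If `t ν₂(ℝ^d) ≤ Λ`, then `e^{-tΦ₁} ≤
e^{2Λ} e^{-tΦ}`, so (A1) bounds the Lipschitz constant of the transform of `e^{-tΦ₁}`; its value at
`0` is at least of order `h(t)^{-d}`, hence so are its values on a ball of radius a multiple of
`h(t)`. With `ν₂ = 0` this also yields `θ`.

The four regimes: (1) the bound (ii), since `η₀ ≤ θ`. (2) One jump (`single_jump_bound`): `ν₂` is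
the part of `ν` outside a ball of radius `η₀h(t)/2`, with expected number of jumps bounded by a
constant. (3) `gaussian_bound`: the diagonal bound is chained over about `|x|²/(m₀t)` equal time
steps, each long enough that `h(s)²` is at least of order `m₀s`; each step costs a constant factor.
(4) `exists_far_bound`: `ν₂` is `κ₀ dx` on the ball of radius `r₀`, and about `2|x|/r₀` of its jumps
are used; the weight `(κ₀ t r₀^d)^n / n!` produces the logarithm, and every other loss is
exponential in `|x|/r₀` and is absorbed into `c₄`.

The constant `L₀` comes from averaging `Φ` along the coordinate axes (`exists_isPsiConstant`). -/

/-! ### Cosine transforms and the compound Poisson series -/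

/-- The cosine transform of a function with respect to Lebesgue measure. -/
def cosInt (f : Rd d → ℝ) (x : Rd d) : ℝ := ∫ ξ, Real.cos ⟪x, ξ⟫ * f ξ

/-- The cosine transform of a measure. -/
def cosT (μ : Measure (Rd d)) (ξ : Rd d) : ℝ := ∫ z, Real.cos ⟪ξ, z⟫ ∂μ

/-- Measures whose sine transform vanishes. -/
def SinFree (μ : Measure (Rd d)) : Prop := ∀ ξ : Rd d, ∫ z, Real.sin ⟪ξ, z⟫ ∂μ = 0

lemma integrable_cos_mul {f : Rd d → ℝ} (hf : Integrable f) (x : Rd d) :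
    Integrable (fun ξ => Real.cos ⟪x, ξ⟫ * f ξ) :=
  hf.bdd_mul (c := 1) (by fun_prop) (Eventually.of_forall fun ξ => Real.abs_cos_le_one _)

lemma integrable_cos_inner (μ : Measure (Rd d)) [IsFiniteMeasure μ] (ξ : Rd d) :
    Integrable (fun z => Real.cos ⟪ξ, z⟫) μ :=
  (integrable_const (1 : ℝ)).mono' (by fun_prop)
    (Eventually.of_forall fun z => Real.abs_cos_le_one _)

lemma integrable_sin_inner (μ : Measure (Rd d)) [IsFiniteMeasure μ] (ξ : Rd d) :
    Integrable (fun z => Real.sin ⟪ξ, z⟫) μ :=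
  (integrable_const (1 : ℝ)).mono' (by fun_prop)
    (Eventually.of_forall fun z => Real.abs_sin_le_one _)

lemma continuous_cosInt {f : Rd d → ℝ} (hf : Integrable f) : Continuous (cosInt f) := by
  refine continuous_of_dominated (bound := fun ξ => |f ξ|)
    (fun x => (integrable_cos_mul hf x).aestronglyMeasurable) (fun x => ?_) hf.abs ?_
  · refine Eventually.of_forall fun ξ => ?_
    rw [norm_mul]
    exact mul_le_of_le_one_left (abs_nonneg _) (Real.abs_cos_le_one _)
  · exact Eventually.of_forall fun ξ => by fun_prop

lemma abs_cosInt_le {f : Rd d → ℝ} (hf : Integrable f) (x : Rd d) :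
    |cosInt f x| ≤ ∫ ξ, |f ξ| := by
  refine (norm_integral_le_integral_norm _).trans
    (integral_mono (integrable_cos_mul hf x).norm hf.abs fun ξ => ?_)
  rw [norm_mul]
  exact mul_le_of_le_one_left (abs_nonneg _) (Real.abs_cos_le_one _)

lemma continuous_cosT (μ : Measure (Rd d)) [IsFiniteMeasure μ] : Continuous (cosT μ) :=
  continuous_of_dominated (bound := fun _ => 1) (fun ξ => by fun_prop)
    (fun ξ => Eventually.of_forall fun z => Real.abs_cos_le_one _) (integrable_const _)
    (Eventually.of_forall fun z => by fun_prop)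

lemma abs_cosT_le (μ : Measure (Rd d)) [IsFiniteMeasure μ] (ξ : Rd d) :
    |cosT μ ξ| ≤ μ.real Set.univ := by
  refine (norm_integral_le_integral_norm _).trans
    ((integral_mono (integrable_cos_inner μ ξ).norm (integrable_const (1 : ℝ))
      fun z => Real.abs_cos_le_one _).trans ?_)
  simp

lemma integrable_mul_cosT {f : Rd d → ℝ} (hf : Integrable f) (μ : Measure (Rd d))
    [IsFiniteMeasure μ] : Integrable (fun ξ => f ξ * cosT μ ξ) :=
  hf.mul_bdd (c := μ.real Set.univ) (continuous_cosT μ).aestronglyMeasurable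
    (Eventually.of_forall fun ξ => abs_cosT_le μ ξ)

lemma integrable_mul_cosT_pow {f : Rd d → ℝ} (hf : Integrable f) (μ : Measure (Rd d))
    [IsFiniteMeasure μ] (k : ℕ) : Integrable (fun ξ => f ξ * cosT μ ξ ^ k) := by
  induction k with
  | zero => simpa using hf
  | succ k ih => simpa only [pow_succ, mul_assoc] using integrable_mul_cosT ih μ

/-- Multiplication by the transform of a measure corresponds to convolution. -/
lemma cosInt_mul_cosT {f : Rd d → ℝ} (hf : Integrable f) {μ : Measure (Rd d)}
    [IsFiniteMeasure μ] (hμ : SinFree μ) (x : Rd d) :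
    cosInt (fun ξ => f ξ * cosT μ ξ) x = ∫ z, cosInt f (x - z) ∂μ := by
  have hint : Integrable (Function.uncurry fun (z ξ : Rd d) => Real.cos ⟪x - z, ξ⟫ * f ξ)
      (μ.prod volume) := by
    have h1 : Integrable (fun p : Rd d × Rd d => (fun _ : Rd d => (1 : ℝ)) p.1 * f p.2)
        (μ.prod volume) := (integrable_const (1 : ℝ)).mul_prod hf
    simp only [one_mul] at h1
    refine h1.bdd_mul (c := 1) ?_ (Eventually.of_forall fun p => Real.abs_cos_le_one _)
    exact (by fun_prop : Continuous fun p : Rd d × Rd d =>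
      Real.cos ⟪x - p.1, p.2⟫).aestronglyMeasurable
  have hswap := integral_integral_swap hint
  unfold cosInt
  rw [hswap]
  refine integral_congr_ae (Eventually.of_forall fun ξ => ?_)
  have h2 : ∀ z : Rd d, Real.cos ⟪x - z, ξ⟫ * f ξ
      = (Real.cos ⟪x, ξ⟫ * f ξ) * Real.cos ⟪ξ, z⟫ + (Real.sin ⟪x, ξ⟫ * f ξ) * Real.sin ⟪ξ, z⟫ := by
    intro z
    rw [inner_sub_left, Real.cos_sub, real_inner_comm z ξ]
    ring
  simp only [h2]
  rw [integral_add ((integrable_cos_inner μ ξ).const_mul _)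
    ((integrable_sin_inner μ ξ).const_mul _), integral_const_mul, integral_const_mul, hμ ξ]
  simp only [cosT]
  ring

lemma integrable_cosInt_sub {f : Rd d → ℝ} (hf : Integrable f) (μ : Measure (Rd d))
    [IsFiniteMeasure μ] (x : Rd d) : Integrable (fun z => cosInt f (x - z)) μ :=
  (integrable_const (∫ ξ, |f ξ|)).mono'
    ((continuous_cosInt hf).comp (by fun_prop : Continuous fun z => x - z)).aestronglyMeasurable
    (Eventually.of_forall fun z => abs_cosInt_le hf (x - z))

lemma cosInt_mul_cosT_pow_succ {f : Rd d → ℝ} (hf : Integrable f) {μ : Measure (Rd d)}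
    [IsFiniteMeasure μ] (hμ : SinFree μ) (k : ℕ) (x : Rd d) :
    cosInt (fun ξ => f ξ * cosT μ ξ ^ (k + 1)) x
      = ∫ z, cosInt (fun ξ => f ξ * cosT μ ξ ^ k) (x - z) ∂μ := by
  rw [← cosInt_mul_cosT (integrable_mul_cosT_pow hf μ k) hμ x]
  simp only [pow_succ, mul_assoc]

lemma cosInt_mul_cosT_pow_nonneg {f : Rd d → ℝ} (hf : Integrable f) (h0 : ∀ x, 0 ≤ cosInt f x)
    {μ : Measure (Rd d)} [IsFiniteMeasure μ] (hμ : SinFree μ) (k : ℕ) (x : Rd d) :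
    0 ≤ cosInt (fun ξ => f ξ * cosT μ ξ ^ k) x := by
  induction k generalizing x with
  | zero => simpa using h0 x
  | succ k ih =>
    rw [cosInt_mul_cosT_pow_succ hf hμ]
    exact integral_nonneg fun z => ih _

/-- The `k`-th term of the compound Poisson series is a lower bound. -/
lemma cosInt_mul_exp_ge {f : Rd d → ℝ} (hf : Integrable f) (h0 : ∀ x, 0 ≤ cosInt f x)
    {μ : Measure (Rd d)} [IsFiniteMeasure μ] (hμ : SinFree μ) {t : ℝ} (ht : 0 ≤ t)
    (k : ℕ) (x : Rd d) :
    t ^ k / k.factorial * cosInt (fun ξ => f ξ * cosT μ ξ ^ k) x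
      ≤ cosInt (fun ξ => f ξ * Real.exp (t * cosT μ ξ)) x := by
  have hexp : ∀ u : ℝ, HasSum (fun n : ℕ => u ^ n / n.factorial) (Real.exp u) := by
    intro u
    rw [Real.exp_eq_exp_ℝ]
    exact NormedSpace.expSeries_div_hasSum_exp u
  set B : ℝ := t * μ.real Set.univ with hB
  -- Sum and integral are interchanged with the dominating terms `|f| Bⁿ/n!`, whose sum `|f| e^B` is
  -- integrable.
  have hsum : HasSum (fun n : ℕ => ∫ ξ, Real.cos ⟪x, ξ⟫ *
      (t ^ n / n.factorial * (f ξ * cosT μ ξ ^ n)))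
      (∫ ξ, Real.cos ⟪x, ξ⟫ * (f ξ * Real.exp (t * cosT μ ξ))) := by
    refine hasSum_integral_of_dominated_convergence
      (fun n ξ => |f ξ| * (B ^ n / n.factorial)) (fun n => ?_) (fun n => ?_) ?_ ?_ ?_
    · exact (integrable_cos_mul ((integrable_mul_cosT_pow hf μ n).const_mul _)
        x).aestronglyMeasurable
    · refine Eventually.of_forall fun ξ => ?_
      rw [norm_mul, norm_mul, norm_mul, norm_div, norm_pow, norm_pow, Real.norm_natCast,
        Real.norm_of_nonneg ht, hB, mul_pow]
      have h1 : ‖cosT μ ξ‖ ^ n ≤ μ.real Set.univ ^ n :=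
        pow_le_pow_left₀ (norm_nonneg _) (abs_cosT_le μ ξ) n
      have h2 : ‖Real.cos ⟪x, ξ⟫‖ ≤ 1 := Real.abs_cos_le_one _
      calc ‖Real.cos ⟪x, ξ⟫‖ * (t ^ n / n.factorial * (‖f ξ‖ * ‖cosT μ ξ‖ ^ n))
          ≤ 1 * (t ^ n / n.factorial * (‖f ξ‖ * μ.real Set.univ ^ n)) := by gcongr
        _ = |f ξ| * (t ^ n * μ.real Set.univ ^ n / n.factorial) := by
          rw [Real.norm_eq_abs]; ring
    · exact Eventually.of_forall fun ξ => ((hexp B).summable.mul_left _)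
    · have h3 : (fun ξ => ∑' n : ℕ, |f ξ| * (B ^ n / n.factorial))
          = fun ξ => |f ξ| * Real.exp B := by
        funext ξ
        rw [tsum_mul_left, (hexp B).tsum_eq]
      rw [h3]
      exact hf.abs.mul_const _
    · refine Eventually.of_forall fun ξ => ?_
      have h4 := ((hexp (t * cosT μ ξ)).mul_left (f ξ)).mul_left (Real.cos ⟪x, ξ⟫)
      refine HasSum.congr_fun h4 fun n => ?_
      rw [mul_pow]
      ring
  have hterm : ∀ n : ℕ, ∫ ξ, Real.cos ⟪x, ξ⟫ * (t ^ n / n.factorial * (f ξ * cosT μ ξ ^ n))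
      = t ^ n / n.factorial * cosInt (fun ξ => f ξ * cosT μ ξ ^ n) x := by
    intro n
    rw [cosInt, ← integral_const_mul]
    congr 1
    funext ξ
    ring
  simp only [hterm] at hsum
  -- The other terms are iterated convolutions of a nonnegative function with a positive measure, so
  -- they may be dropped.
  exact le_hasSum hsum k fun n _ => mul_nonneg (by positivity)
    (cosInt_mul_cosT_pow_nonneg hf h0 hμ n x)

lemma cosInt_mul_exp_nonneg {f : Rd d → ℝ} (hf : Integrable f) (h0 : ∀ x, 0 ≤ cosInt f x)
    {μ : Measure (Rd d)} [IsFiniteMeasure μ] (hμ : SinFree μ) {t : ℝ} (ht : 0 ≤ t)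
    (x : Rd d) : 0 ≤ cosInt (fun ξ => f ξ * Real.exp (t * cosT μ ξ)) x := by
  refine le_trans ?_ (cosInt_mul_exp_ge hf h0 hμ ht 0 x)
  simpa using h0 x

lemma cosInt_const_mul (c : ℝ) (f : Rd d → ℝ) (x : Rd d) :
    cosInt (fun ξ => c * f ξ) x = c * cosInt f x := by
  simp only [cosInt, ← integral_const_mul]
  congr 1
  funext ξ
  ring

/-- The cosine is 1-Lipschitz, so the first absolute moment of `f` is a Lipschitz constant for its
transform. This is how (A1) enters the lower bounds. -/
lemma cosInt_sub_le {f : Rd d → ℝ} (hf : Integrable f) (hf1 : Integrable fun ξ => ‖ξ‖ * |f ξ|)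
    (x : Rd d) : cosInt f 0 - ‖x‖ * ∫ ξ, ‖ξ‖ * |f ξ| ≤ cosInt f x := by
  have h1 : cosInt f 0 - cosInt f x = ∫ ξ, (Real.cos ⟪(0 : Rd d), ξ⟫ * f ξ
      - Real.cos ⟪x, ξ⟫ * f ξ) := by
    rw [integral_sub (integrable_cos_mul hf 0) (integrable_cos_mul hf x)]
    rfl
  have h2 : cosInt f 0 - cosInt f x ≤ ∫ ξ, ‖x‖ * (‖ξ‖ * |f ξ|) := by
    rw [h1]
    refine integral_mono ((integrable_cos_mul hf 0).sub (integrable_cos_mul hf x))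
      (hf1.const_mul _) fun ξ => ?_
    simp only [inner_zero_left, Real.cos_zero]
    rw [← sub_mul]
    refine (le_abs_self _).trans ?_
    rw [abs_mul, ← mul_assoc]
    refine mul_le_mul_of_nonneg_right ?_ (abs_nonneg _)
    have h3 : |Real.cos 0 - Real.cos ⟪x, ξ⟫| ≤ |0 - ⟪x, ξ⟫| := Real.abs_cos_sub_cos_le _ _
    rw [Real.cos_zero, zero_sub, abs_neg] at h3
    exact h3.trans (abs_real_inner_le_norm x ξ)
  rw [integral_const_mul] at h2
  linarith

lemma cosInt_gaussian {b : ℝ} (hb : 0 < b) (x : Rd d) :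
    cosInt (fun ξ => Real.exp (-b * ‖ξ‖ ^ 2)) x
      = (Real.pi / b) ^ (d / 2 : ℝ) * Real.exp (-(‖x‖ ^ 2 / (4 * b))) := by
  have h := GaussianFourier.integral_cexp_neg_mul_sq_norm_add (V := Rd d) (b := (b : ℂ))
    (by simpa using hb) Complex.I x
  have h2 := congrArg Complex.re h
  have hi : Integrable fun v : Rd d =>
      Complex.exp (-(b : ℂ) * (‖v‖ : ℂ) ^ 2 + Complex.I * ((⟪x, v⟫ : ℝ) : ℂ)) := 
    GaussianFourier.integrable_cexp_neg_mul_sq_norm_add (by simpa using hb) Complex.I x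
  rw [← RCLike.re_eq_complex_re, ← integral_re hi] at h2
  have h3 : ∀ v : Rd d, RCLike.re (Complex.exp (-(b : ℂ) * (‖v‖ : ℂ) ^ 2
      + Complex.I * ((⟪x, v⟫ : ℝ) : ℂ))) = Real.cos ⟪x, v⟫ * Real.exp (-b * ‖v‖ ^ 2) := by
    intro v
    rw [RCLike.re_eq_complex_re, Complex.exp_re]
    have e1 : (-(b : ℂ) * (‖v‖ : ℂ) ^ 2 + Complex.I * ((⟪x, v⟫ : ℝ) : ℂ)).re = -b * ‖v‖ ^ 2 := by
      simp [← Complex.ofReal_pow]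
    have e2 : (-(b : ℂ) * (‖v‖ : ℂ) ^ 2 + Complex.I * ((⟪x, v⟫ : ℝ) : ℂ)).im = ⟪x, v⟫ := by
      simp [← Complex.ofReal_pow]
    rw [e1, e2]
    ring
  simp only [h3] at h2
  rw [cosInt, h2]
  have h4 : ((Real.pi : ℂ) / b) ^ ((Module.finrank ℝ (Rd d) : ℂ) / 2)
      * Complex.exp (Complex.I ^ 2 * (‖x‖ : ℂ) ^ 2 / (4 * b))
      = (((Real.pi / b) ^ (d / 2 : ℝ) * Real.exp (-(‖x‖ ^ 2 / (4 * b))) : ℝ) : ℂ) := by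
    push_cast
    rw [Complex.ofReal_cpow (by positivity)]
    simp only [Complex.I_sq, finrank_euclideanSpace, Fintype.card_fin]
    push_cast
    congr 2
    ring
  rw [h4]
  exact Complex.ofReal_re _

/-! ### Symmetric Lévy measures and positivity of the transform of `e^{-tΦ}` -/

/-- Symmetric measures that integrate `1 ∧ |y|²`. -/
structure IsSymLevy (ν : Measure (Rd d)) : Prop where
  finite : ∫⁻ y, ENNReal.ofReal (min 1 (‖y‖ ^ 2)) ∂ν < ∞
  neg : ν.IsNegInvariant

lemma IsSymmLevyMeasure.isSymLevy {ν : Measure (Rd d)} (h : IsSymmLevyMeasure ν) :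
    IsSymLevy ν where
  finite := h.finite
  neg := by
    constructor
    ext D hD
    rw [Measure.neg, Measure.map_apply measurable_neg hD]
    exact h.symm D hD

/-- Truncations of `ν` may have finite mass, so the decompositions of `ν` are carried out in this
larger class, which is stable under passing to symmetric minorants. -/
lemma IsSymLevy.mono {ν μ : Measure (Rd d)} (h : IsSymLevy ν) (hμ : μ ≤ ν)
    (hneg : μ.IsNegInvariant) : IsSymLevy μ :=
  ⟨(lintegral_mono' hμ le_rfl).trans_lt h.finite, hneg⟩

lemma isNegInvariant_restrict {μ : Measure (Rd d)} (h : μ.IsNegInvariant) {S : Set (Rd d)}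
    (hS : MeasurableSet S) (hneg : ∀ y, -y ∈ S ↔ y ∈ S) : (μ.restrict S).IsNegInvariant := by
  constructor
  ext D hD
  have h2 : (fun y : Rd d => -y) ⁻¹' (D ∩ S) = (fun y => -y) ⁻¹' D ∩ S := by
    ext y
    simp [hneg]
  rw [Measure.neg, Measure.map_apply measurable_neg hD, Measure.restrict_apply hD,
    Measure.restrict_apply (measurable_neg hD)]
  change μ ((fun y : Rd d => -y) ⁻¹' D ∩ S) = _
  rw [← h2]
  conv_rhs => rw [← h.neg_eq_self, Measure.neg, Measure.map_apply measurable_neg (hD.inter hS)]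

lemma sinFree_of_isNegInvariant {μ : Measure (Rd d)} (h : μ.IsNegInvariant) : SinFree μ := by
  intro ξ
  have h1 := integral_neg_eq_self (fun z => Real.sin ⟪ξ, z⟫) μ
  simp only [inner_neg_right, Real.sin_neg, integral_neg] at h1
  linarith

lemma measurableSet_norm_gt (r : ℝ) : MeasurableSet {y : Rd d | r < ‖y‖} :=
  measurableSet_lt measurable_const measurable_norm

lemma IsSymLevy.restrict_norm_gt {ν : Measure (Rd d)} (h : IsSymLevy ν) (r : ℝ) :
    IsSymLevy (ν.restrict {y | r < ‖y‖}) :=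
  h.mono Measure.restrict_le_self
    (isNegInvariant_restrict h.neg (measurableSet_norm_gt r) fun y => by simp)

lemma IsSymLevy.restrict_norm_gt_compl {ν : Measure (Rd d)} (h : IsSymLevy ν) (r : ℝ) :
    IsSymLevy (ν.restrict {y | r < ‖y‖}ᶜ) :=
  h.mono Measure.restrict_le_self
    (isNegInvariant_restrict h.neg (measurableSet_norm_gt r).compl fun y => by simp)

lemma IsSymLevy.integrable_min {ν : Measure (Rd d)} (h : IsSymLevy ν) :
    Integrable (fun y => min 1 (‖y‖ ^ 2)) ν := by
  refine ⟨by fun_prop, ?_⟩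
  rw [hasFiniteIntegral_iff_ofReal (Eventually.of_forall fun y => by positivity)]
  exact h.finite

lemma IsSymLevy.measure_norm_gt_lt_top {ν : Measure (Rd d)} (h : IsSymLevy ν) {r : ℝ}
    (hr : 0 < r) : ν {y | r < ‖y‖} < ∞ := by
  refine (measure_mono fun y (hy : r < ‖y‖) => ?_).trans_lt
    (h.integrable_min.measure_ge_lt_top (ε := min 1 (r ^ 2)) (by positivity))
  exact min_le_min le_rfl (pow_le_pow_left₀ hr.le hy.le 2)

lemma IsSymLevy.isFiniteMeasure_restrict {ν : Measure (Rd d)} (h : IsSymLevy ν) {r : ℝ}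
    (hr : 0 < r) : IsFiniteMeasure (ν.restrict {y | r < ‖y‖}) :=
  ⟨by simpa using h.measure_norm_gt_lt_top hr⟩

lemma one_sub_cos_nonneg (u : ℝ) : 0 ≤ 1 - Real.cos u := by
  linarith [Real.cos_le_one u]

lemma one_sub_cos_inner_le (ξ y : Rd d) :
    1 - Real.cos ⟪ξ, y⟫ ≤ (2 + ‖ξ‖ ^ 2) * min 1 (‖y‖ ^ 2) := by
  have h1 : 1 - Real.cos ⟪ξ, y⟫ ≤ ‖ξ‖ ^ 2 * ‖y‖ ^ 2 := by
    have h2 := Real.one_sub_sq_div_two_le_cos (x := ⟪ξ, y⟫)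
    have h3 : ⟪ξ, y⟫ ^ 2 ≤ (‖ξ‖ * ‖y‖) ^ 2 :=
      sq_le_sq' (by linarith [neg_abs_le ⟪ξ, y⟫, abs_real_inner_le_norm ξ y])
        (real_inner_le_norm ξ y)
    nlinarith [sq_nonneg (‖ξ‖ * ‖y‖)]
  have h4 := Real.neg_one_le_cos ⟪ξ, y⟫
  rcases le_total 1 (‖y‖ ^ 2) with h | h
  · rw [min_eq_left h]
    nlinarith [sq_nonneg ‖ξ‖]
  · rw [min_eq_right h]
    nlinarith [sq_nonneg ‖y‖]

lemma IsSymLevy.integrable_one_sub_cos {ν : Measure (Rd d)} (h : IsSymLevy ν) (ξ : Rd d) :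
    Integrable (fun y => 1 - Real.cos ⟪ξ, y⟫) ν :=
  (h.integrable_min.const_mul (2 + ‖ξ‖ ^ 2)).mono' (by fun_prop)
    (Eventually.of_forall fun y => by
      rw [Real.norm_of_nonneg (one_sub_cos_nonneg _)]
      exact one_sub_cos_inner_le ξ y)

lemma Phi_nonneg (ν : Measure (Rd d)) (ξ : Rd d) : 0 ≤ Phi ν ξ :=
  integral_nonneg fun _ => one_sub_cos_nonneg _

@[simp] lemma Phi_zero (ν : Measure (Rd d)) : Phi ν 0 = 0 := by
  simp [Phi]

lemma Phi_neg (ν : Measure (Rd d)) (ξ : Rd d) : Phi ν (-ξ) = Phi ν ξ := by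
  simp [Phi]

lemma IsSymLevy.continuous_Phi {ν : Measure (Rd d)} (h : IsSymLevy ν) :
    Continuous (Phi ν) := by
  rw [continuous_iff_continuousAt]
  intro ξ₀
  refine continuousAt_of_dominated (bound := fun y => (2 + (‖ξ₀‖ + 1) ^ 2) * min 1 (‖y‖ ^ 2))
    (Eventually.of_forall fun ξ => (h.integrable_one_sub_cos ξ).aestronglyMeasurable) ?_
    (h.integrable_min.const_mul _) (Eventually.of_forall fun y => by fun_prop)
  filter_upwards [Metric.ball_mem_nhds ξ₀ one_pos] with ξ hξ
  refine Eventually.of_forall fun y => ?_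
  rw [Real.norm_of_nonneg (one_sub_cos_nonneg _)]
  refine (one_sub_cos_inner_le ξ y).trans ?_
  have h1 : ‖ξ‖ ≤ ‖ξ₀‖ + 1 := by
    have := norm_le_norm_add_norm_sub' ξ ξ₀
    rw [mem_ball_iff_norm] at hξ
    linarith
  gcongr

lemma Phi_add {ν μ : Measure (Rd d)} (hν : IsSymLevy ν) (hμ : IsSymLevy μ) (ξ : Rd d) :
    Phi (ν + μ) ξ = Phi ν ξ + Phi μ ξ :=
  integral_add_measure (hν.integrable_one_sub_cos ξ) (hμ.integrable_one_sub_cos ξ)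

lemma isSymLevy_of_isFiniteMeasure {μ : Measure (Rd d)} [IsFiniteMeasure μ]
    (h : μ.IsNegInvariant) : IsSymLevy μ := by
  refine ⟨?_, h⟩
  calc ∫⁻ y, ENNReal.ofReal (min 1 (‖y‖ ^ 2)) ∂μ ≤ ∫⁻ _, 1 ∂μ := by
        refine lintegral_mono fun y => ?_
        rw [← ENNReal.ofReal_one]
        exact ENNReal.ofReal_le_ofReal (min_le_left _ _)
    _ < ∞ := by simp

lemma Phi_of_isFiniteMeasure (μ : Measure (Rd d)) [IsFiniteMeasure μ] (ξ : Rd d) :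
    Phi μ ξ = μ.real Set.univ - cosT μ ξ := by
  rw [Phi, integral_sub (integrable_const _) (integrable_cos_inner μ ξ)]
  simp [cosT]

lemma exp_neg_mul_Phi_of_isFiniteMeasure (μ : Measure (Rd d)) [IsFiniteMeasure μ] (t : ℝ)
    (ξ : Rd d) : Real.exp (-t * Phi μ ξ)
      = Real.exp (-t * μ.real Set.univ) * Real.exp (t * cosT μ ξ) := by
  rw [Phi_of_isFiniteMeasure, ← Real.exp_add]
  ring_nf

lemma IsSymLevy.tendsto_Phi_restrict {ν : Measure (Rd d)} (h : IsSymLevy ν) (ξ : Rd d) :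
    Tendsto (fun n : ℕ => Phi (ν.restrict {y | 1 / ((n : ℝ) + 1) < ‖y‖}) ξ) atTop
      (𝓝 (Phi ν ξ)) := by
  have h1 : ∀ n : ℕ, Phi (ν.restrict {y | 1 / ((n : ℝ) + 1) < ‖y‖}) ξ
      = ∫ y, {y : Rd d | 1 / ((n : ℝ) + 1) < ‖y‖}.indicator (fun y => 1 - Real.cos ⟪ξ, y⟫) y ∂ν :=
    fun n => (integral_indicator (measurableSet_norm_gt _)).symm
  simp only [h1]
  refine tendsto_integral_of_dominated_convergence (fun y => 1 - Real.cos ⟪ξ, y⟫)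
    (fun n => ((h.integrable_one_sub_cos ξ).indicator
      (measurableSet_norm_gt _)).aestronglyMeasurable)
    (h.integrable_one_sub_cos ξ) (fun n => Eventually.of_forall fun y => ?_)
    (Eventually.of_forall fun y => ?_)
  · refine (norm_indicator_le_norm_self _ _).trans ?_
    rw [Real.norm_of_nonneg (one_sub_cos_nonneg _)]
  -- At the origin the integrand is `1 - cos 0 = 0`, so a possible atom there plays no role.
  · rcases eq_or_ne y 0 with rfl | hy
    · simp [Set.indicator]
    · refine tendsto_const_nhds.congr' ?_
      have h2 := (tendsto_one_div_add_atTop_nhds_zero_nat (𝕜 := ℝ)).eventually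
        (gt_mem_nhds (norm_pos_iff.2 hy))
      filter_upwards [h2] with n hn
      rw [Set.indicator_of_mem (by exact hn)]

lemma integrable_gaussian {b : ℝ} (hb : 0 < b) :
    Integrable fun ξ : Rd d => Real.exp (-b * ‖ξ‖ ^ 2) := by
  have h := (GaussianFourier.integrable_cexp_neg_mul_sq_norm_add (V := Rd d) (b := (b : ℂ))
    (by simpa using hb) 0 0).re
  refine h.congr (Eventually.of_forall fun v => ?_)
  simp [Complex.exp_re, ← Complex.ofReal_pow]

lemma cosInt_gaussian_nonneg {b : ℝ} (hb : 0 < b) (x : Rd d) :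
    0 ≤ cosInt (fun ξ => Real.exp (-b * ‖ξ‖ ^ 2)) x := by
  rw [cosInt_gaussian hb]
  positivity

lemma exp_neg_mul_Phi_le_one (ν : Measure (Rd d)) {t : ℝ} (ht : 0 ≤ t) (ξ : Rd d) :
    Real.exp (-t * Phi ν ξ) ≤ 1 := by
  rw [Real.exp_le_one_iff]
  nlinarith [Phi_nonneg ν ξ]

/-- Removing the jumps of size at most `1/(n+1)` leaves a finite measure, for which the exponential
series has nonnegative terms; then `n → ∞`. The Gaussian factor is needed because `e^{-tΦ}` is not
integrable for a finite Lévy measure. -/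
lemma IsSymLevy.cosInt_gaussian_mul_nonneg {ν : Measure (Rd d)} (h : IsSymLevy ν) {t b : ℝ}
    (ht : 0 ≤ t) (hb : 0 < b) (x : Rd d) :
    0 ≤ cosInt (fun ξ => Real.exp (-b * ‖ξ‖ ^ 2) * Real.exp (-t * Phi ν ξ)) x := by
  have hlim : Tendsto (fun n : ℕ => cosInt (fun ξ => Real.exp (-b * ‖ξ‖ ^ 2) *
      Real.exp (-t * Phi (ν.restrict {y | 1 / ((n : ℝ) + 1) < ‖y‖}) ξ)) x) atTop
      (𝓝 (cosInt (fun ξ => Real.exp (-b * ‖ξ‖ ^ 2) * Real.exp (-t * Phi ν ξ)) x)) := by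
    refine tendsto_integral_of_dominated_convergence (fun ξ => Real.exp (-b * ‖ξ‖ ^ 2))
      (fun n => ?_) (integrable_gaussian hb) (fun n => Eventually.of_forall fun ξ => ?_)
      (Eventually.of_forall fun ξ => ?_)
    · have := (h.restrict_norm_gt (1 / ((n : ℝ) + 1))).continuous_Phi
      exact (by fun_prop : Continuous _).aestronglyMeasurable
    · rw [norm_mul, norm_mul, Real.norm_of_nonneg (Real.exp_pos _).le,
        Real.norm_of_nonneg (Real.exp_pos _).le]
      have h1 : ‖Real.cos ⟪x, ξ⟫‖ ≤ 1 := Real.abs_cos_le_one _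
      have h2 := exp_neg_mul_Phi_le_one (ν.restrict {y | 1 / ((n : ℝ) + 1) < ‖y‖}) ht ξ
      calc _ ≤ 1 * (Real.exp (-b * ‖ξ‖ ^ 2) * 1) := by gcongr
        _ = _ := by ring
    · exact (((Real.continuous_exp.tendsto _).comp
        ((h.tendsto_Phi_restrict ξ).const_mul (-t))).const_mul _).const_mul _
  refine ge_of_tendsto' hlim fun n => ?_
  have hpos : (0 : ℝ) < 1 / ((n : ℝ) + 1) := by positivity
  have := h.isFiniteMeasure_restrict hpos
  have h3 : (fun ξ => Real.exp (-b * ‖ξ‖ ^ 2) *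
      Real.exp (-t * Phi (ν.restrict {y | 1 / ((n : ℝ) + 1) < ‖y‖}) ξ))
      = fun ξ => Real.exp (-t * (ν.restrict {y | 1 / ((n : ℝ) + 1) < ‖y‖}).real Set.univ) *
        (Real.exp (-b * ‖ξ‖ ^ 2) *
          Real.exp (t * cosT (ν.restrict {y | 1 / ((n : ℝ) + 1) < ‖y‖}) ξ)) := by
    funext ξ
    rw [exp_neg_mul_Phi_of_isFiniteMeasure]
    ring
  rw [h3, cosInt_const_mul]
  exact mul_nonneg (Real.exp_pos _).le (cosInt_mul_exp_nonneg (integrable_gaussian hb)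
    (cosInt_gaussian_nonneg hb) (sinFree_of_isNegInvariant (h.restrict_norm_gt _).neg) ht x)

lemma IsSymLevy.cosInt_nonneg {ν : Measure (Rd d)} (h : IsSymLevy ν) {t : ℝ}
    (ht : 0 ≤ t) (hint : Integrable fun ξ => Real.exp (-t * Phi ν ξ)) (x : Rd d) :
    0 ≤ cosInt (fun ξ => Real.exp (-t * Phi ν ξ)) x := by
  have hlim : Tendsto (fun n : ℕ => cosInt (fun ξ => Real.exp (-(1 / ((n : ℝ) + 1)) * ‖ξ‖ ^ 2) *
      Real.exp (-t * Phi ν ξ)) x) atTop (𝓝 (cosInt (fun ξ => Real.exp (-t * Phi ν ξ)) x)) := by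
    refine tendsto_integral_of_dominated_convergence (fun ξ => Real.exp (-t * Phi ν ξ))
      (fun n => ?_) hint (fun n => Eventually.of_forall fun ξ => ?_)
      (Eventually.of_forall fun ξ => ?_)
    · have := h.continuous_Phi
      exact (by fun_prop : Continuous _).aestronglyMeasurable
    · rw [norm_mul, norm_mul, Real.norm_of_nonneg (Real.exp_pos _).le,
        Real.norm_of_nonneg (Real.exp_pos _).le]
      have h1 : ‖Real.cos ⟪x, ξ⟫‖ ≤ 1 := Real.abs_cos_le_one _
      have h2 : Real.exp (-(1 / ((n : ℝ) + 1)) * ‖ξ‖ ^ 2) ≤ 1 := by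
        rw [Real.exp_le_one_iff, neg_mul, neg_nonpos]
        positivity
      calc _ ≤ 1 * (1 * Real.exp (-t * Phi ν ξ)) := by gcongr
        _ = _ := by ring
    · have h3 : Tendsto (fun n : ℕ => Real.exp (-(1 / ((n : ℝ) + 1)) * ‖ξ‖ ^ 2)) atTop (𝓝 1) := by
        have h4 := ((tendsto_one_div_add_atTop_nhds_zero_nat (𝕜 := ℝ)).neg.mul_const (‖ξ‖ ^ 2))
        have h5 := (Real.continuous_exp.tendsto _).comp h4
        simp only [neg_zero, zero_mul, Real.exp_zero] at h5
        exact h5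
      simpa using (h3.mul_const (Real.exp (-t * Phi ν ξ))).const_mul (Real.cos ⟪x, ξ⟫)
  exact ge_of_tendsto' hlim fun n => h.cosInt_gaussian_mul_nonneg ht (by positivity) x

/-! ### Fourier inversion, the semigroup and its densities -/

/-- The normalizing constant `(2π)^{-d}` of Fourier inversion. -/
def fourierConst (d : ℕ) : ℝ := ((2 * Real.pi) ^ d)⁻¹

lemma fourierConst_pos (d : ℕ) : 0 < fourierConst d := by
  unfold fourierConst
  positivity

lemma integral_cexp_mul_ofReal {μ : Measure (Rd d)} {φ θ : Rd d → ℝ} (hφ : Integrable φ μ)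
    (hθ : Continuous θ) :
    ∫ v, Complex.exp ((θ v : ℂ) * Complex.I) * (φ v : ℂ) ∂μ
      = ((∫ v, Real.cos (θ v) * φ v ∂μ : ℝ) : ℂ)
        + ((∫ v, Real.sin (θ v) * φ v ∂μ : ℝ) : ℂ) * Complex.I := by
  have hc : Integrable (fun v => Real.cos (θ v) * φ v) μ :=
    hφ.bdd_mul (c := 1) (by fun_prop) (Eventually.of_forall fun v => Real.abs_cos_le_one _)
  have hs : Integrable (fun v => Real.sin (θ v) * φ v) μ :=
    hφ.bdd_mul (c := 1) (by fun_prop) (Eventually.of_forall fun v => Real.abs_sin_le_one _)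
  rw [← integral_complex_ofReal, ← integral_complex_ofReal, ← integral_mul_const,
    ← integral_add hc.ofReal (hs.ofReal.mul_const _)]
  congr 1
  funext v
  rw [Complex.exp_mul_I]
  push_cast
  ring

/-- Change of variables between the kernel `e^{2πi⟨v,x⟩}` and the probabilistic normalization. Both
signs `c = ±2π` occur, one for each direction of inversion. -/
lemma cosInt_eq_integral_smul (g : Rd d → ℝ) (x : Rd d) {c : ℝ} (hc : |c| = 2 * Real.pi) :
    ∫ v, Real.cos (c * ⟪v, x⟫) * g (c • v) = fourierConst d * cosInt g x := by
  have h := Measure.integral_comp_smul (volume : Measure (Rd d))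
    (fun ξ => Real.cos ⟪x, ξ⟫ * g ξ) c
  simp only [finrank_euclideanSpace, Fintype.card_fin, abs_inv, abs_pow, hc, smul_eq_mul] at h
  rw [fourierConst, cosInt, ← h]
  congr 1
  funext v
  rw [inner_smul_right, real_inner_comm]

lemma charFun_withDensity {q : Rd d → ℝ} (hq : Continuous q) (hq0 : ∀ x, 0 ≤ q x) (ξ : Rd d) :
    charFun (volume.withDensity fun x => ENNReal.ofReal (q x)) ξ
      = ∫ x, Complex.exp ((⟪x, ξ⟫ : ℝ) * Complex.I) * (q x : ℂ) := by
  rw [charFun_apply, integral_withDensity_eq_integral_toReal_smul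
    (by fun_prop) (Eventually.of_forall fun x => ENNReal.ofReal_lt_top)]
  congr 1
  funext x
  rw [ENNReal.toReal_ofReal (hq0 x), Complex.real_smul, mul_comm]

lemma integrable_of_isFiniteMeasure_withDensity {q : Rd d → ℝ} (hq : Continuous q)
    (hq0 : ∀ x, 0 ≤ q x)
    (h : IsFiniteMeasure (volume.withDensity fun x => ENNReal.ofReal (q x))) :
    Integrable q := by
  refine ⟨hq.aestronglyMeasurable, ?_⟩
  rw [hasFiniteIntegral_iff_ofReal (Eventually.of_forall hq0)]
  have h1 := h.measure_univ_lt_top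
  rwa [withDensity_apply _ MeasurableSet.univ, Measure.restrict_univ] at h1

/-- Fourier inversion for a continuous density. -/
lemma density_eq_cosInt {q g : Rd d → ℝ} (hq : Continuous q) (hq0 : ∀ x, 0 ≤ q x)
    (hg : Integrable g)
    (h : IsFiniteMeasure (volume.withDensity fun x => ENNReal.ofReal (q x)))
    (hchar : ∀ ξ, charFun (volume.withDensity fun x => ENNReal.ofReal (q x)) ξ = (g ξ : ℂ))
    (x : Rd d) : q x = fourierConst d * cosInt g x := by
  have hqi := integrable_of_isFiniteMeasure_withDensity hq hq0 h
  have hpi : (0 : ℝ) < 2 * Real.pi := by positivity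
  have hF : 𝓕 (fun v => (q v : ℂ)) = fun w => (g ((-(2 * Real.pi)) • w) : ℂ) := by
    funext w
    rw [← hchar, charFun_withDensity hq hq0, Real.fourier_eq']
    congr 1
    funext v
    rw [inner_smul_right, smul_eq_mul]
    congr 3
    push_cast
    ring
  have hgi : Integrable fun w => g ((-(2 * Real.pi)) • w) :=
    hg.comp_smul (by simp [Real.pi_ne_zero])
  have hinv := Continuous.fourierInv_fourier_eq (f := fun v => (q v : ℂ)) (by fun_prop)
    hqi.ofReal (by rw [hF]; exact hgi.ofReal)
  have h2 := congrFun hinv x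
  rw [hF, Real.fourierInv_eq'] at h2
  simp only [smul_eq_mul] at h2
  rw [integral_cexp_mul_ofReal hgi (by fun_prop)] at h2
  have h3 := congrArg Complex.re h2
  simp only [Complex.add_re, Complex.mul_re, Complex.ofReal_re, Complex.ofReal_im, Complex.I_re,
    Complex.I_im, mul_zero, zero_mul, sub_zero, add_zero] at h3
  rw [← h3, ← cosInt_eq_integral_smul g x (c := -(2 * Real.pi))
    (by rw [abs_neg, abs_of_pos hpi])]
  congr 1
  funext v
  rw [neg_mul, Real.cos_neg]

lemma integral_cosInt_mul {f g : Rd d → ℝ} (hf : Integrable f) (hg : Integrable g) :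
    ∫ x, cosInt f x * g x = ∫ ξ, f ξ * cosInt g ξ := by
  have hint : Integrable (Function.uncurry fun (x ξ : Rd d) => Real.cos ⟪x, ξ⟫ * (g x * f ξ))
      (volume.prod volume) := by
    refine (hg.mul_prod hf).bdd_mul (c := 1) ?_
      (Eventually.of_forall fun p => Real.abs_cos_le_one _)
    exact (by fun_prop : Continuous fun p : Rd d × Rd d =>
      Real.cos ⟪p.1, p.2⟫).aestronglyMeasurable
  have h := integral_integral_swap hint
  simp only [cosInt, ← integral_const_mul, ← integral_mul_const]
  rw [show (fun x : Rd d => ∫ ξ, Real.cos ⟪x, ξ⟫ * f ξ * g x)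
      = fun x => ∫ ξ, Real.cos ⟪x, ξ⟫ * (g x * f ξ) from ?_, h]
  · congr 1
    funext ξ
    congr 1
    funext x
    rw [real_inner_comm]
    ring
  · funext x
    congr 1
    funext ξ
    ring

lemma integral_cosInt_gaussian {b : ℝ} (hb : 0 < b) :
    Integrable (cosInt fun ξ : Rd d => Real.exp (-b * ‖ξ‖ ^ 2)) ∧
    ∫ x : Rd d, cosInt (fun ξ => Real.exp (-b * ‖ξ‖ ^ 2)) x = (4 * Real.pi ^ 2) ^ (d / 2 : ℝ) := by
  have hb' : (0 : ℝ) < 1 / (4 * b) := by positivity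
  have h1 : (cosInt fun ξ : Rd d => Real.exp (-b * ‖ξ‖ ^ 2))
      = fun x => (Real.pi / b) ^ (d / 2 : ℝ) * Real.exp (-(1 / (4 * b)) * ‖x‖ ^ 2) := by
    funext x
    rw [cosInt_gaussian hb]
    ring_nf
  rw [h1]
  refine ⟨(integrable_gaussian hb').const_mul _, ?_⟩
  rw [integral_const_mul, GaussianFourier.integral_rexp_neg_mul_sq_norm hb',
    finrank_euclideanSpace, Fintype.card_fin, ← Real.mul_rpow (by positivity) (by positivity)]
  congr 1
  field_simp

/-- A nonnegative cosine transform of a bounded integrable function is integrable. -/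
lemma integrable_cosInt {f : Rd d → ℝ} (hf : Integrable f) (h0 : ∀ x, 0 ≤ cosInt f x)
    (h1 : ∀ ξ, f ξ ≤ 1) : Integrable (cosInt f) := by
  have hcov : AECover (volume : Measure (Rd d)) atTop
      (fun n : ℕ => Metric.closedBall (0 : Rd d) ((n : ℝ) + 1)) :=
    aecover_closedBall (tendsto_atTop_add_const_right _ _ tendsto_natCast_atTop_atTop)
  refine hcov.integrable_of_integral_norm_bounded
    (Real.exp 1 * (4 * Real.pi ^ 2) ^ (d / 2 : ℝ))
    (fun n => (continuous_cosInt hf).continuousOn.integrableOn_compact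
      (isCompact_closedBall _ _)) (Eventually.of_forall fun n => ?_)
  -- With this width the Gaussian is at least `e^{-1}` on the ball of radius `n + 1`. Fubini moves
  -- the Gaussian to the transform side, where its transform has total mass `(2π)^d` whatever `b`
  -- is, so the bound is uniform in `n`.
  set b : ℝ := 1 / ((n : ℝ) + 1) ^ 2 with hb
  have hb0 : 0 < b := by positivity
  have hG := integrable_gaussian (d := d) hb0
  have hi : Integrable fun x => cosInt f x * Real.exp (-b * ‖x‖ ^ 2) :=
    hG.bdd_mul (continuous_cosInt hf).aestronglyMeasurable
      (Eventually.of_forall fun x => abs_cosInt_le hf x)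
  obtain ⟨hGi, hGv⟩ := integral_cosInt_gaussian (d := d) hb0
  calc ∫ x in Metric.closedBall (0 : Rd d) ((n : ℝ) + 1), ‖cosInt f x‖
      ≤ ∫ x in Metric.closedBall (0 : Rd d) ((n : ℝ) + 1),
          Real.exp 1 * (cosInt f x * Real.exp (-b * ‖x‖ ^ 2)) := by
        refine setIntegral_mono_on ?_ (hi.const_mul _).integrableOn
          Metric.isClosed_closedBall.measurableSet fun x hx => ?_
        · exact ((continuous_cosInt hf).norm.continuousOn.integrableOn_compact
            (isCompact_closedBall _ _))
        · rw [Real.norm_of_nonneg (h0 x)]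
          have hx' : ‖x‖ ≤ (n : ℝ) + 1 := by simpa using hx
          have h2 : b * ‖x‖ ^ 2 ≤ 1 := by
            rw [hb, one_div_mul_eq_div, div_le_one (by positivity)]
            gcongr
          have h3 : 1 ≤ Real.exp 1 * Real.exp (-b * ‖x‖ ^ 2) := by
            rw [← Real.exp_add, Real.one_le_exp_iff]
            linarith
          calc cosInt f x = cosInt f x * 1 := (mul_one _).symm
            _ ≤ cosInt f x * (Real.exp 1 * Real.exp (-b * ‖x‖ ^ 2)) :=
              mul_le_mul_of_nonneg_left h3 (h0 x)
            _ = _ := by ring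
    _ ≤ ∫ x, Real.exp 1 * (cosInt f x * Real.exp (-b * ‖x‖ ^ 2)) :=
        setIntegral_le_integral (hi.const_mul _) (Eventually.of_forall fun x =>
          mul_nonneg (Real.exp_pos _).le (mul_nonneg (h0 x) (Real.exp_pos _).le))
    _ = Real.exp 1 * ∫ ξ, f ξ * cosInt (fun ξ => Real.exp (-b * ‖ξ‖ ^ 2)) ξ := by
        rw [integral_const_mul, integral_cosInt_mul hf hG]
    _ ≤ Real.exp 1 * ∫ ξ, cosInt (fun ξ : Rd d => Real.exp (-b * ‖ξ‖ ^ 2)) ξ := by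
        refine mul_le_mul_of_nonneg_left (integral_mono ?_ hGi fun ξ => ?_) (Real.exp_pos _).le
        · exact hf.mul_bdd (continuous_cosInt hG).aestronglyMeasurable
            (Eventually.of_forall fun x => abs_cosInt_le hG x)
        · exact mul_le_of_le_one_left (cosInt_gaussian_nonneg hb0 ξ) (h1 ξ)
    _ = _ := by rw [hGv]

lemma integral_sin_mul_eq_zero {g : Rd d → ℝ} (heven : ∀ ξ, g (-ξ) = g ξ) (w : Rd d) (c : ℝ) :
    ∫ v, Real.sin (c * ⟪v, w⟫) * g v = 0 := by
  have h := integral_neg_eq_self (fun v => Real.sin (c * ⟪v, w⟫) * g v) volume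
  simp only [inner_neg_left, mul_neg, Real.sin_neg, heven, neg_mul, integral_neg] at h
  linarith

/-- Fourier inversion from the transform side. -/
lemma charFun_cosInt {g : Rd d → ℝ} (hgc : Continuous g) (hg : Integrable g)
    (heven : ∀ ξ, g (-ξ) = g ξ) (h0 : ∀ x, 0 ≤ cosInt g x) (h1 : ∀ ξ, g ξ ≤ 1) (ξ : Rd d) :
    charFun (volume.withDensity fun x => ENNReal.ofReal (fourierConst d * cosInt g x)) ξ
      = (g ξ : ℂ) := by
  have hpi : (0 : ℝ) < 2 * Real.pi := by positivity
  have hgi : Integrable fun w => g ((2 * Real.pi) • w) := hg.comp_smul hpi.ne'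
  have hF : 𝓕 (fun v => (g ((2 * Real.pi) • v) : ℂ))
      = fun w => ((fourierConst d * cosInt g w : ℝ) : ℂ) := by
    funext w
    rw [Real.fourier_eq']
    simp only [smul_eq_mul]
    rw [integral_cexp_mul_ofReal hgi (by fun_prop),
      integral_sin_mul_eq_zero (g := fun v => g ((2 * Real.pi) • v)) (by simp [heven]),
      ← cosInt_eq_integral_smul g w (c := 2 * Real.pi) (abs_of_pos hpi)]
    simp only [Complex.ofReal_zero, zero_mul, add_zero]
    congr 2
    funext v
    rw [neg_mul, neg_mul, Real.cos_neg]
  have hinv := Continuous.fourierInv_fourier_eq (f := fun v => (g ((2 * Real.pi) • v) : ℂ))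
    (by fun_prop) hgi.ofReal
    (by rw [hF]; exact ((integrable_cosInt hg h0 h1).const_mul _).ofReal)
  have h2 := congrFun hinv ((2 * Real.pi)⁻¹ • ξ)
  rw [hF, Real.fourierInv_eq'] at h2
  simp only [smul_smul, mul_inv_cancel₀ hpi.ne', one_smul] at h2
  rw [← h2, charFun_withDensity ((continuous_cosInt hg).const_mul _)
    fun x => mul_nonneg (fourierConst_pos d).le (h0 x)]
  congr 1
  funext x
  rw [inner_smul_right, smul_eq_mul, mul_inv_cancel_left₀ hpi.ne']

/-- The Lévy semigroup and its continuous densities exist once `e^{-tΦ}` is integrable. -/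
lemma IsSymLevy.exists_semigroup {ν : Measure (Rd d)} (h : IsSymLevy ν)
    (hint : ∀ t : ℝ, 0 < t → Integrable fun ξ => Real.exp (-t * Phi ν ξ)) :
    ∃ (P : ℝ → Measure (Rd d)) (p : ℝ → Rd d → ℝ),
      IsLevySemigroup ν P ∧ IsTransitionDensity P p := by
  let p : ℝ → Rd d → ℝ := fun t x => fourierConst d * cosInt (fun ξ => Real.exp (-t * Phi ν ξ)) x
  let P : ℝ → Measure (Rd d) := fun t =>
    if t = 0 then Measure.dirac 0 else volume.withDensity fun x => ENNReal.ofReal (p t x)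
  have hchar : ∀ t : ℝ, 0 < t → ∀ ξ,
      charFun (volume.withDensity fun x => ENNReal.ofReal (p t x)) ξ
        = ((Real.exp (-t * Phi ν ξ) : ℝ) : ℂ) := by
    intro t ht ξ
    have hcont := h.continuous_Phi
    exact charFun_cosInt (by fun_prop) (hint t ht) (fun ξ => by rw [Phi_neg])
      (h.cosInt_nonneg ht.le (hint t ht)) (exp_neg_mul_Phi_le_one ν ht.le) ξ
  refine ⟨P, p, fun t ht => ?_, fun t ht => ⟨?_, fun x => ?_, ?_⟩⟩
  · rcases ht.eq_or_lt with rfl | ht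
    · have hP : P 0 = Measure.dirac 0 := if_pos rfl
      rw [hP]
      exact ⟨inferInstance, fun ξ => by simp [charFun_dirac]⟩
    · have hP : P t = volume.withDensity fun x => ENNReal.ofReal (p t x) := if_neg ht.ne'
      rw [hP]
      refine ⟨⟨?_⟩, hchar t ht⟩
      have h1 := hchar t ht 0
      rw [charFun_zero, Phi_zero, mul_zero, Real.exp_zero] at h1
      have h2 : (volume.withDensity fun x => ENNReal.ofReal (p t x)).real Set.univ = 1 := by
        exact_mod_cast h1
      rw [← ENNReal.toReal_eq_one_iff]
      exact h2
  · exact (continuous_cosInt (hint t ht)).const_mul _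
  · exact mul_nonneg (fourierConst_pos d).le (h.cosInt_nonneg ht.le (hint t ht) x)
  · exact if_neg ht.ne'

/-- The continuous density is given by Fourier inversion. -/
lemma transitionDensity_eq {ν : Measure (Rd d)} {P : ℝ → Measure (Rd d)} {p : ℝ → Rd d → ℝ}
    (hP : IsLevySemigroup ν P) (hp : IsTransitionDensity P p) {t : ℝ} (ht : 0 < t)
    (hint : Integrable fun ξ => Real.exp (-t * Phi ν ξ)) (x : Rd d) :
    p t x = fourierConst d * cosInt (fun ξ => Real.exp (-t * Phi ν ξ)) x := by
  obtain ⟨hc, h0, hd⟩ := hp t ht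
  obtain ⟨hprob, hchar⟩ := hP t ht.le
  rw [hd] at hprob hchar
  exact density_eq_cosInt hc h0 hint inferInstance hchar x

/-- Real and imaginary parts of the characteristic function. This allows `P s` itself to be the
convolving measure in `cosInt_mul_cosT`, which gives Chapman–Kolmogorov. -/
lemma cosT_of_charFun {μ : Measure (Rd d)} [IsFiniteMeasure μ] {g : Rd d → ℝ}
    (hchar : ∀ ξ, charFun μ ξ = (g ξ : ℂ)) : SinFree μ ∧ cosT μ = g := by
  have h : ∀ ξ, (g ξ : ℂ) = ((cosT μ ξ : ℝ) : ℂ)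
      + ((∫ z, Real.sin ⟪ξ, z⟫ ∂μ : ℝ) : ℂ) * Complex.I := by
    intro ξ
    have h1 := integral_cexp_mul_ofReal (μ := μ) (integrable_const (1 : ℝ))
      (by fun_prop : Continuous fun z : Rd d => ⟪z, ξ⟫)
    simp only [Complex.ofReal_one, mul_one] at h1
    rw [← hchar, charFun_apply, h1]
    simp only [cosT, real_inner_comm]
  refine ⟨fun ξ => ?_, funext fun ξ => ?_⟩
  · simpa using (congrArg Complex.im (h ξ)).symm
  · simpa using (congrArg Complex.re (h ξ)).symm

/-- The Chapman–Kolmogorov equation. -/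
lemma transitionDensity_add {ν : Measure (Rd d)} {P : ℝ → Measure (Rd d)} {p : ℝ → Rd d → ℝ}
    (hP : IsLevySemigroup ν P) (hp : IsTransitionDensity P p)
    (hint : ∀ t : ℝ, 0 < t → Integrable fun ξ => Real.exp (-t * Phi ν ξ))
    {s t : ℝ} (hs : 0 < s) (ht : 0 < t) (x : Rd d) :
    p (t + s) x = ∫ z, p t (x - z) * p s z := by
  have hprob := (hP s hs.le).1
  obtain ⟨h1, h2⟩ := cosT_of_charFun (hP s hs.le).2
  have h3 := cosInt_mul_cosT (hint t ht) h1 x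
  obtain ⟨hc, h0, hd⟩ := hp s hs
  rw [transitionDensity_eq hP hp (by positivity) (hint _ (by positivity))]
  have h4 : (fun ξ => Real.exp (-(t + s) * Phi ν ξ))
      = fun ξ => Real.exp (-t * Phi ν ξ) * cosT (P s) ξ := by
    funext ξ
    rw [h2, ← Real.exp_add]
    ring_nf
  rw [h4, h3, ← integral_const_mul, hd, integral_withDensity_eq_integral_toReal_smul
    (by fun_prop) (Eventually.of_forall fun x => ENNReal.ofReal_lt_top)]
  congr 1
  funext z
  rw [transitionDensity_eq hP hp ht (hint t ht), ENNReal.toReal_ofReal (h0 z), smul_eq_mul,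
    mul_comm]

/-! ### Comparison of `Ψ` and `H`: existence of `L₀` -/

lemma IsSymLevy.sigmaFinite {ν : Measure (Rd d)} (h : IsSymLevy ν) (h0 : ν {0} = 0) :
    SigmaFinite ν := by
  refine ⟨⟨⟨fun n : ℕ => {0} ∪ {y | 1 / ((n : ℝ) + 1) < ‖y‖}, fun _ => trivial, fun n => ?_, ?_⟩⟩⟩
  · refine (measure_union_le _ _).trans_lt ?_
    rw [h0, zero_add]
    exact h.measure_norm_gt_lt_top (by positivity)
  · refine Set.eq_univ_of_forall fun y => ?_
    rcases eq_or_ne y 0 with rfl | hy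
    · exact Set.mem_iUnion.2 ⟨0, Or.inl rfl⟩
    · obtain ⟨n, hn⟩ := exists_nat_one_div_lt (norm_pos_iff.2 hy)
      exact Set.mem_iUnion.2 ⟨n, Or.inr hn⟩

/-- The average of `1 - cos (s u)` over `s ∈ (0, 1]` controls `1 ∧ u²`. -/
lemma min_le_integral_one_sub_cos (u : ℝ) :
    1 / 15 * min 1 (u ^ 2) ≤ ∫ s in Set.Ioc (0 : ℝ) 1, (1 - Real.cos (s * u)) := by
  rw [← intervalIntegral.integral_of_le zero_le_one]
  have hpi : Real.pi ^ 2 ≤ 10 := by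
    nlinarith [Real.pi_lt_d2, Real.pi_gt_three]
  -- For `|u| ≤ π` the bound `1 - cos v ≥ 2v²/π²` integrates to `2u²/(3π²) ≥ u²/15`. For `|u| > π`
  -- the integral is `1 - sin u / u ≥ 2/3`.
  rcases le_or_gt |u| Real.pi with hu | hu
  · have h1 : ∫ s in (0 : ℝ)..1, 2 / Real.pi ^ 2 * u ^ 2 * s ^ 2 = 2 / Real.pi ^ 2 * u ^ 2 / 3 := by
      rw [intervalIntegral.integral_const_mul, integral_pow]
      norm_num
      ring
    have h2 : ∫ s in (0 : ℝ)..1, 2 / Real.pi ^ 2 * u ^ 2 * s ^ 2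
        ≤ ∫ s in (0 : ℝ)..1, (1 - Real.cos (s * u)) := by
      refine intervalIntegral.integral_mono_on zero_le_one
        (Continuous.intervalIntegrable (by fun_prop) _ _)
        (Continuous.intervalIntegrable (by fun_prop) _ _) fun s hs => ?_
      have h3 : |s * u| ≤ Real.pi := by
        rw [abs_mul, abs_of_nonneg hs.1]
        exact (mul_le_of_le_one_left (abs_nonneg _) hs.2).trans hu
      have := Real.cos_le_one_sub_mul_cos_sq h3
      rw [mul_pow] at this
      linarith
    have h4 : 1 / 15 ≤ 2 / Real.pi ^ 2 / 3 := by
      rw [div_div, div_le_div_iff₀ (by norm_num) (by positivity)]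
      linarith
    calc 1 / 15 * min 1 (u ^ 2) ≤ 2 / Real.pi ^ 2 / 3 * u ^ 2 :=
          mul_le_mul h4 (min_le_right _ _) (by positivity) (by positivity)
      _ = 2 / Real.pi ^ 2 * u ^ 2 / 3 := by ring
      _ ≤ _ := by linarith
  · have hu0 : u ≠ 0 := by
      rintro rfl
      rw [abs_zero] at hu
      linarith [Real.pi_pos]
    have h1 : ∫ s in (0 : ℝ)..1, (1 - Real.cos (s * u)) = 1 - u⁻¹ * Real.sin u := by
      rw [intervalIntegral.integral_sub (by simp)
        (Continuous.intervalIntegrable (by fun_prop) _ _),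
        intervalIntegral.integral_comp_mul_right (fun x => Real.cos x) hu0]
      simp
    have h2 : |u⁻¹ * Real.sin u| ≤ 1 / 3 := by
      rw [abs_mul, abs_inv]
      have h3 : |u|⁻¹ ≤ 1 / 3 := by
        rw [← one_div]
        exact one_div_le_one_div_of_le (by norm_num) (by linarith [Real.pi_gt_three])
      calc |u|⁻¹ * |Real.sin u| ≤ 1 / 3 * 1 :=
            mul_le_mul h3 (Real.abs_sin_le_one _) (abs_nonneg _) (by norm_num)
        _ = _ := by norm_num
    rw [h1]
    have := (abs_le.1 h2).2
    have h5 := min_le_left 1 (u ^ 2)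
    linarith

lemma IsSymLevy.integrable_min_mul {ν : Measure (Rd d)} (h : IsSymLevy ν) (r : ℝ) :
    Integrable (fun y => min 1 (r ^ 2 * ‖y‖ ^ 2)) ν := by
  refine (h.integrable_min.const_mul (1 + r ^ 2)).mono' (by fun_prop)
    (Eventually.of_forall fun y => ?_)
  rw [Real.norm_of_nonneg (by positivity)]
  rcases le_total 1 (‖y‖ ^ 2) with hy | hy
  · rw [min_eq_left hy]
    exact (min_le_left _ _).trans (by nlinarith [sq_nonneg r])
  · rw [min_eq_right hy]
    exact (min_le_right _ _).trans (by nlinarith [sq_nonneg ‖y‖])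

lemma min_sum_le {ι : Type*} (s : Finset ι) (a : ι → ℝ) (ha : ∀ i, 0 ≤ a i) :
    min 1 (∑ i ∈ s, a i) ≤ ∑ i ∈ s, min 1 (a i) := by
  have hnn : ∀ i ∈ s, 0 ≤ min 1 (a i) := fun i _ => le_min zero_le_one (ha i)
  by_cases h : ∃ i ∈ s, 1 ≤ a i
  · obtain ⟨i, hi, h1⟩ := h
    calc min 1 (∑ i ∈ s, a i) ≤ min 1 (a i) := by rw [min_eq_left h1]; exact min_le_left _ _
      _ ≤ _ := Finset.single_le_sum hnn hi
  · push Not at h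
    refine (min_le_right _ _).trans (le_of_eq (Finset.sum_congr rfl fun i hi => ?_))
    rw [min_eq_right (h i hi).le]

lemma Psi_bddAbove {ν : Measure (Rd d)} (h : IsSymLevy ν) (r : ℝ) :
    BddAbove (Phi ν '' Metric.closedBall 0 r) :=
  ((isCompact_closedBall _ _).image h.continuous_Phi).bddAbove

lemma Phi_le_Psi {ν : Measure (Rd d)} (h : IsSymLevy ν) {r : ℝ} {ξ : Rd d} (hξ : ‖ξ‖ ≤ r) :
    Phi ν ξ ≤ Psi ν r :=
  le_csSup (Psi_bddAbove h r) ⟨ξ, by simpa using hξ, rfl⟩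

lemma Psi_le_two_mul {ν : Measure (Rd d)} (h : IsSymLevy ν) {r : ℝ} (hr : 0 ≤ r) :
    Psi ν r ≤ 2 * HFun ν r := by
  refine csSup_le ⟨_, ⟨0, by simpa using hr, rfl⟩⟩ ?_
  rintro _ ⟨ξ, hξ, rfl⟩
  have hξ' : ‖ξ‖ ≤ r := by simpa using hξ
  rw [Phi, HFun, ← integral_const_mul]
  refine integral_mono (h.integrable_one_sub_cos ξ) ((h.integrable_min_mul r).const_mul 2)
    fun y => ?_
  have h1 : 1 - Real.cos ⟪ξ, y⟫ ≤ r ^ 2 * ‖y‖ ^ 2 := by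
    have h2 := Real.one_sub_sq_div_two_le_cos (x := ⟪ξ, y⟫)
    have h3 : ⟪ξ, y⟫ ^ 2 ≤ (r * ‖y‖) ^ 2 := by
      rw [← sq_abs]
      exact pow_le_pow_left₀ (abs_nonneg _) ((abs_real_inner_le_norm ξ y).trans (by gcongr)) 2
    nlinarith [sq_nonneg (r * ‖y‖)]
  have h4 := Real.neg_one_le_cos ⟪ξ, y⟫
  change 1 - Real.cos ⟪ξ, y⟫ ≤ 2 * min 1 (r ^ 2 * ‖y‖ ^ 2)
  rcases le_total 1 (r ^ 2 * ‖y‖ ^ 2) with hy | hy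
  · rw [min_eq_left hy]
    linarith
  · rw [min_eq_right hy]
    nlinarith [sq_nonneg (r * ‖y‖)]

lemma IsSymLevy.integrable_min_coord {ν : Measure (Rd d)} (h : IsSymLevy ν) (r : ℝ)
    (j : Fin d) : Integrable (fun y : Rd d => min 1 (r ^ 2 * y j ^ 2)) ν := by
  refine (h.integrable_min_mul r).mono' (by fun_prop) (Eventually.of_forall fun y => ?_)
  rw [Real.norm_of_nonneg (by positivity)]
  refine min_le_min_left 1 ?_
  have : y j ^ 2 ≤ ‖y‖ ^ 2 := by
    rw [← sq_abs]
    exact pow_le_pow_left₀ (abs_nonneg _) (PiLp.norm_apply_le y j) 2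
  gcongr

/-- `Φ` is averaged over the segment from `0` to `r e_j`, which stays in the ball of radius `r`;
Fubini moves the average inside the integral against `ν`, where `min_le_integral_one_sub_cos`
applies. -/
lemma integral_min_coord_le_Psi {ν : Measure (Rd d)} (h : IsSymLevy ν) [SFinite ν] {r : ℝ}
    (hr : 0 ≤ r) (j : Fin d) : 1 / 15 * ∫ y, min 1 (r ^ 2 * y j ^ 2) ∂ν ≤ Psi ν r := by
  set e : Rd d := EuclideanSpace.single j (1 : ℝ) with he
  have hin : ∀ (s : ℝ) (y : Rd d), ⟪(s * r) • e, y⟫ = s * (r * y j) := by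
    intro s y
    rw [inner_smul_left, he, EuclideanSpace.inner_single_left]
    simp
    ring
  have hnorm : ∀ s ∈ Set.Ioc (0 : ℝ) 1, ‖(s * r) • e‖ ≤ r := by
    intro s hs
    rw [norm_smul, he, PiLp.norm_single, norm_mul, Real.norm_of_nonneg hs.1.le,
      Real.norm_of_nonneg hr]
    simp only [norm_one, mul_one]
    exact mul_le_of_le_one_left hr hs.2
  have hint : Integrable (Function.uncurry fun (s : ℝ) (y : Rd d) => 1 - Real.cos (s * (r * y j)))
      ((volume.restrict (Set.Ioc (0 : ℝ) 1)).prod ν) := by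
    have h1 : Integrable (fun p : ℝ × Rd d =>
        (fun _ : ℝ => (1 : ℝ)) p.1 * ((2 + r ^ 2) * min 1 (‖p.2‖ ^ 2)))
        ((volume.restrict (Set.Ioc (0 : ℝ) 1)).prod ν) :=
      (integrable_const (1 : ℝ)).mul_prod (h.integrable_min.const_mul (2 + r ^ 2))
    refine h1.mono' ?_ ?_
    · exact (by fun_prop : Continuous fun p : ℝ × Rd d =>
        1 - Real.cos (p.1 * (r * p.2 j))).aestronglyMeasurable
    · have h2 : ∀ᵐ p : ℝ × Rd d ∂((volume.restrict (Set.Ioc (0 : ℝ) 1)).prod ν),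
          p.1 ∈ Set.Ioc (0 : ℝ) 1 :=
        Measure.quasiMeasurePreserving_fst.ae (ae_restrict_mem measurableSet_Ioc)
      filter_upwards [h2] with p hp
      simp only [Function.uncurry, one_mul]
      rw [Real.norm_of_nonneg (one_sub_cos_nonneg _), ← hin]
      refine (one_sub_cos_inner_le _ _).trans ?_
      have := hnorm p.1 hp
      gcongr
  have hswap := integral_integral_swap hint
  have hPhi : ∀ s : ℝ, ∫ y, (1 - Real.cos (s * (r * y j))) ∂ν = Phi ν ((s * r) • e) := by
    intro s
    simp only [Phi, hin]
  have hmin := h.integrable_min_coord r j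
  calc 1 / 15 * ∫ y, min 1 (r ^ 2 * y j ^ 2) ∂ν
      = ∫ y, 1 / 15 * min 1 (r ^ 2 * y j ^ 2) ∂ν := (integral_const_mul _ _).symm
    _ ≤ ∫ y, (∫ s in Set.Ioc (0 : ℝ) 1, (1 - Real.cos (s * (r * y j)))) ∂ν := by
        refine integral_mono (hmin.const_mul _) hint.integral_prod_right fun y => ?_
        have := min_le_integral_one_sub_cos (r * y j)
        rwa [mul_pow] at this
    _ = ∫ s in Set.Ioc (0 : ℝ) 1, Phi ν ((s * r) • e) := by
        rw [← hswap]
        simp only [hPhi]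
    _ ≤ ∫ s in Set.Ioc (0 : ℝ) 1, Psi ν r := by
        refine setIntegral_mono_on ?_ (integrable_const _) measurableSet_Ioc fun s hs =>
          Phi_le_Psi h (hnorm s hs)
        have h4 := hint.integral_prod_left
        simp only [Function.uncurry, hPhi] at h4
        exact h4
    _ = Psi ν r := by simp

theorem exists_isPsiConstant (hd : 0 < d) : ∃ L₀ : ℝ, IsPsiConstant d L₀ := by
  have hd' : (0 : ℝ) < d := by exact_mod_cast hd
  -- The factor `15` comes from the average along one axis, the factor `d` from summing over the
  -- coordinates by subadditivity of `1 ∧ ·`.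
  refine ⟨1 / (15 * d), by positivity, fun ν hν r hr => ⟨?_, Psi_le_two_mul hν.isSymLevy hr.le⟩⟩
  have h := hν.isSymLevy
  have := h.sigmaFinite hν.zero
  have hmin := fun j => h.integrable_min_coord r j
  have h1 : HFun ν r ≤ ∑ j : Fin d, ∫ y, min 1 (r ^ 2 * y j ^ 2) ∂ν := by
    rw [← integral_finsetSum _ fun j _ => hmin j]
    refine integral_mono (h.integrable_min_mul r) (integrable_finsetSum _ fun j _ => hmin j)
      fun y => ?_
    have h2 : r ^ 2 * ‖y‖ ^ 2 = ∑ j : Fin d, r ^ 2 * y j ^ 2 := by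
      rw [EuclideanSpace.real_norm_sq_eq, Finset.mul_sum]
    change min 1 (r ^ 2 * ‖y‖ ^ 2) ≤ _
    rw [h2]
    exact min_sum_le _ _ fun j => by positivity
  have h3 : ∑ j : Fin d, ∫ y, min 1 (r ^ 2 * y j ^ 2) ∂ν ≤ ∑ _j : Fin d, 15 * Psi ν r :=
    Finset.sum_le_sum fun j _ => by linarith [integral_min_coord_le_Psi h hr.le j]
  rw [Finset.sum_const, Finset.card_univ, Fintype.card_fin, nsmul_eq_mul] at h3
  rw [one_div_mul_eq_div, div_le_iff₀ (by positivity)]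
  linarith

/-! ### The generalized inverse of `Ψ` and the scale `h` -/

lemma Psi_mono {ν : Measure (Rd d)} (h : IsSymLevy ν) {r r' : ℝ} (hr : 0 ≤ r) (hrr : r ≤ r') :
    Psi ν r ≤ Psi ν r' :=
  csSup_le_csSup (Psi_bddAbove h r') ⟨_, ⟨0, by simpa using hr, rfl⟩⟩
    (Set.image_mono (Metric.closedBall_subset_closedBall hrr))

lemma Psi_zero (ν : Measure (Rd d)) : Psi ν 0 = 0 := by
  simp [Psi]

/-- Rescaling to the unit ball turns `Ψ` into a supremum over a fixed compact set, which depends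
continuously on the parameter. -/
lemma exists_continuous_eq_Psi {ν : Measure (Rd d)} (h : IsSymLevy ν) :
    ∃ F : ℝ → ℝ, Continuous F ∧ ∀ r, 0 ≤ r → F r = Psi ν r := by
  refine ⟨fun r => sSup ((fun ζ => Phi ν (r • ζ)) '' Metric.closedBall 0 1), ?_, fun r hr => ?_⟩
  · refine IsCompact.continuous_sSup (f := fun r ζ => Phi ν (r • ζ)) (isCompact_closedBall _ _) ?_
    exact h.continuous_Phi.comp (by fun_prop : Continuous fun p : ℝ × Rd d => p.1 • p.2)
  · have h1 : Metric.closedBall (0 : Rd d) r = (fun ζ => r • ζ) '' Metric.closedBall 0 1 := by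
      rw [Set.image_smul, smul_unitClosedBall, Real.norm_of_nonneg hr]
    simp only [Psi]
    rw [h1, Set.image_image]

/-- `H(n+1)` dominates `ν(|y| > 1/(n+1))`, and these masses increase to `ν(ℝ^d) = ∞` because the
origin carries no mass. Hence `Ψ ≥ L₀H` is unbounded. -/
lemma exists_lt_Psi {L₀ : ℝ} (hL : IsPsiConstant d L₀) {ν : Measure (Rd d)}
    (hν : IsSymmLevyMeasure ν) (s : ℝ) : ∃ r, 0 < r ∧ s < Psi ν r := by
  by_contra! hcon
  have h := hν.isSymLevy
  have h1 : ∀ n : ℕ, ν {y | 1 / ((n : ℝ) + 1) < ‖y‖} ≤ ENNReal.ofReal (s / L₀) := by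
    intro n
    have hn : (0 : ℝ) < (n : ℝ) + 1 := by positivity
    have h2 : HFun ν ((n : ℝ) + 1) ≤ s / L₀ := by
      rw [le_div_iff₀ hL.1, mul_comm]
      exact (hL.2 ν hν _ hn).1.trans (hcon _ hn)
    have := h.isFiniteMeasure_restrict (r := 1 / ((n : ℝ) + 1)) (by positivity)
    have h3 : ν.real {y | 1 / ((n : ℝ) + 1) < ‖y‖} ≤ HFun ν ((n : ℝ) + 1) := by
      have h4 : ν.real {y | 1 / ((n : ℝ) + 1) < ‖y‖} • (1 : ℝ)
          ≤ ∫ y in {y | 1 / ((n : ℝ) + 1) < ‖y‖}, min 1 (((n : ℝ) + 1) ^ 2 * ‖y‖ ^ 2) ∂ν := by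
        refine setIntegral_ge_of_const_le (measurableSet_norm_gt _)
          (h.measure_norm_gt_lt_top (by positivity)).ne (fun y hy => ?_)
          (h.integrable_min_mul _).integrableOn
        have hy' : 1 / ((n : ℝ) + 1) < ‖y‖ := hy
        rw [div_lt_iff₀ hn] at hy'
        rw [← mul_pow]
        exact le_min le_rfl (one_le_pow₀ (by linarith))
      rw [smul_eq_mul, mul_one] at h4
      exact h4.trans (setIntegral_le_integral (h.integrable_min_mul _)
        (Eventually.of_forall fun y => by positivity))
    rw [← ENNReal.ofReal_toReal (h.measure_norm_gt_lt_top (r := 1 / ((n : ℝ) + 1))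
      (by positivity)).ne]
    exact ENNReal.ofReal_le_ofReal (h3.trans h2)
  have hmono : Monotone fun n : ℕ => {y : Rd d | 1 / ((n : ℝ) + 1) < ‖y‖} := by
    intro m n hmn y (hy : 1 / ((m : ℝ) + 1) < ‖y‖)
    refine lt_of_le_of_lt (b := 1 / ((m : ℝ) + 1)) ?_ hy
    have : (m : ℝ) ≤ n := by exact_mod_cast hmn
    gcongr
  have hU : (Set.univ : Set (Rd d)) ⊆ {0} ∪ ⋃ n : ℕ, {y | 1 / ((n : ℝ) + 1) < ‖y‖} := by
    intro y _
    rcases eq_or_ne y 0 with rfl | hy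
    · exact Or.inl rfl
    · obtain ⟨n, hn⟩ := exists_nat_one_div_lt (norm_pos_iff.2 hy)
      exact Or.inr (Set.mem_iUnion.2 ⟨n, hn⟩)
  have h5 : ν Set.univ ≤ ENNReal.ofReal (s / L₀) := by
    refine (measure_mono hU).trans ((measure_union_le _ _).trans ?_)
    rw [hν.zero, zero_add, hmono.measure_iUnion]
    exact iSup_le h1
  rw [hν.infinite] at h5
  exact absurd h5 (by simp)

/-- The level set is nonempty by the intermediate value theorem, closed by continuity, and bounded
because `Ψ` is monotone and exceeds `s` somewhere. So the supremum is attained. -/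
lemma PsiInv_spec {L₀ : ℝ} (hL : IsPsiConstant d L₀) {ν : Measure (Rd d)}
    (hν : IsSymmLevyMeasure ν) {s : ℝ} (hs : 0 < s) :
    0 < PsiInv ν s ∧ Psi ν (PsiInv ν s) = s := by
  obtain ⟨R, hR, hsR⟩ := exists_lt_Psi hL hν s
  obtain ⟨F, hF, hFe⟩ := exists_continuous_eq_Psi hν.isSymLevy
  have hF0 : F 0 = 0 := by rw [hFe 0 le_rfl, Psi_zero]
  have hset : {r : ℝ | 0 < r ∧ Psi ν r = s} = {r | 0 ≤ r} ∩ {r | F r = s} := by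
    ext r
    constructor
    · rintro ⟨h1, h2⟩
      exact ⟨h1.le, (hFe r h1.le).trans h2⟩
    · rintro ⟨h1, h2⟩
      have h1' : 0 ≤ r := h1
      have h2' : F r = s := h2
      refine ⟨h1'.lt_of_ne ?_, (hFe r h1').symm.trans h2'⟩
      rintro rfl
      rw [hF0] at h2'
      exact hs.ne h2'
  have hclosed : IsClosed {r : ℝ | 0 < r ∧ Psi ν r = s} := by
    rw [hset]
    exact (isClosed_le continuous_const continuous_id).inter
      (isClosed_eq hF continuous_const)
  have hne : {r : ℝ | 0 < r ∧ Psi ν r = s}.Nonempty := by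
    rw [hset]
    obtain ⟨r, hr, hr2⟩ := intermediate_value_Icc hR.le hF.continuousOn
      (show s ∈ Set.Icc (F 0) (F R) from ⟨by rw [hF0]; exact hs.le, by
        rw [hFe R hR.le]; exact hsR.le⟩)
    exact ⟨r, hr.1, hr2⟩
  have hbdd : BddAbove {r : ℝ | 0 < r ∧ Psi ν r = s} := by
    refine ⟨R, ?_⟩
    rintro r ⟨_, hr2⟩
    by_contra! hlt
    have := Psi_mono hν.isSymLevy hR.le hlt.le
    linarith
  exact hclosed.csSup_mem hne hbdd

lemma hFun_pos {L₀ : ℝ} (hL : IsPsiConstant d L₀) {ν : Measure (Rd d)}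
    (hν : IsSymmLevyMeasure ν) {t : ℝ} (ht : 0 < t) : 0 < hFun ν t :=
  one_div_pos.2 (PsiInv_spec hL hν (one_div_pos.2 ht)).1

lemma Psi_one_div_hFun {L₀ : ℝ} (hL : IsPsiConstant d L₀) {ν : Measure (Rd d)}
    (hν : IsSymmLevyMeasure ν) {t : ℝ} (ht : 0 < t) : Psi ν (1 / hFun ν t) = 1 / t := by
  rw [hFun, one_div_one_div]
  exact (PsiInv_spec hL hν (one_div_pos.2 ht)).2

lemma hFun_mono {L₀ : ℝ} (hL : IsPsiConstant d L₀) {ν : Measure (Rd d)}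
    (hν : IsSymmLevyMeasure ν) {s t : ℝ} (hs : 0 < s) (hst : s ≤ t) : hFun ν s ≤ hFun ν t := by
  have ht := hs.trans_le hst
  by_contra! hcon
  have h1 := Psi_mono hν.isSymLevy (one_div_pos.2 (hFun_pos hL hν hs)).le
    (one_div_le_one_div_of_le (hFun_pos hL hν ht) hcon.le)
  rw [Psi_one_div_hFun hL hν ht, Psi_one_div_hFun hL hν hs,
    one_div_le_one_div hs ht] at h1
  rw [le_antisymm hst h1] at hcon
  exact lt_irrefl _ hcon

/-- By Chebyshev this bounds the expected number of jumps up to time `t` whose size exceeds a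
multiple of `h(t)`. -/
lemma mul_HFun_le {L₀ : ℝ} (hL : IsPsiConstant d L₀) {ν : Measure (Rd d)}
    (hν : IsSymmLevyMeasure ν) {t : ℝ} (ht : 0 < t) :
    t * HFun ν (1 / hFun ν t) ≤ 1 / L₀ := by
  have h1 := (hL.2 ν hν _ (one_div_pos.2 (hFun_pos hL hν ht))).1
  rw [Psi_one_div_hFun hL hν ht] at h1
  have h2 : t * (L₀ * HFun ν (1 / hFun ν t)) ≤ t * (1 / t) := by gcongr
  rw [mul_one_div_cancel ht.ne'] at h2
  rw [le_div_iff₀ hL.1]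
  linarith

/-! ### Consequences of (A1): near-diagonal bounds and existence of `θ` -/

/-- The Lebesgue measure of the unit ball. -/
def ballVol (d : ℕ) : ℝ := (volume : Measure (Rd d)).real (Metric.ball 0 1)

lemma ballVol_pos (d : ℕ) : 0 < ballVol d :=
  ENNReal.toReal_pos (Metric.measure_ball_pos _ _ one_pos).ne' measure_ball_lt_top.ne

lemma volume_real_ball (x : Rd d) {r : ℝ} (hr : 0 < r) :
    (volume : Measure (Rd d)).real (Metric.ball x r) = r ^ d * ballVol d := by
  rw [measureReal_def, Measure.addHaar_ball_of_pos _ _ hr, ENNReal.toReal_mul,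
    ENNReal.toReal_ofReal (by positivity), finrank_euclideanSpace, Fintype.card_fin]
  rfl

lemma volume_real_closedBall (x : Rd d) {r : ℝ} (hr : 0 < r) :
    (volume : Measure (Rd d)).real (Metric.closedBall x r) = r ^ d * ballVol d := by
  rw [Measure.addHaar_real_closedBall _ _ hr.le, finrank_euclideanSpace, Fintype.card_fin]
  rfl

section CondA1

variable {ν : Measure (Rd d)} {M₀ L₀ t : ℝ}

lemma CondA1.integrable_norm_mul (hA : CondA1 ν M₀ ∞) (h : IsSymLevy ν) (ht : 0 < t) :
    Integrable fun ξ : Rd d => ‖ξ‖ * Real.exp (-t * Phi ν ξ) := by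
  have hc := h.continuous_Phi
  refine ⟨(by fun_prop : Continuous _).aestronglyMeasurable, ?_⟩
  rw [hasFiniteIntegral_iff_ofReal (Eventually.of_forall fun ξ => by positivity)]
  simp only [mul_comm ‖_‖]
  exact (hA t ht ENNReal.ofReal_lt_top).trans_lt ENNReal.ofReal_lt_top

lemma CondA1.integral_norm_mul_le (hA : CondA1 ν M₀ ∞) (hM : 0 < M₀)
    (hL : IsPsiConstant d L₀) (hν : IsSymmLevyMeasure ν) (ht : 0 < t) :
    ∫ ξ : Rd d, ‖ξ‖ * Real.exp (-t * Phi ν ξ) ≤ M₀ * (hFun ν t ^ (d + 1))⁻¹ := by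
  have hc := hν.isSymLevy.continuous_Phi
  have hh := hFun_pos hL hν ht
  rw [integral_eq_lintegral_of_nonneg_ae (Eventually.of_forall fun ξ => by positivity)
    (by fun_prop : Continuous _).aestronglyMeasurable]
  refine ENNReal.toReal_le_of_le_ofReal (by positivity) ?_
  simp only [mul_comm ‖_‖]
  exact hA t ht ENNReal.ofReal_lt_top

lemma CondA1.integrable_exp (hA : CondA1 ν M₀ ∞) (h : IsSymLevy ν) (ht : 0 < t) :
    Integrable fun ξ : Rd d => Real.exp (-t * Phi ν ξ) := by
  have hc := h.continuous_Phi
  have h1 : Integrable ((Metric.closedBall (0 : Rd d) 1).indicator fun _ => (1 : ℝ)) :=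
    (integrable_indicator_iff Metric.isClosed_closedBall.measurableSet).2
      (integrableOn_const (measure_closedBall_lt_top.ne))
  refine (h1.add (hA.integrable_norm_mul h ht)).mono'
    (by fun_prop : Continuous _).aestronglyMeasurable (Eventually.of_forall fun ξ => ?_)
  rw [Real.norm_of_nonneg (Real.exp_pos _).le, Pi.add_apply]
  by_cases hξ : ξ ∈ Metric.closedBall (0 : Rd d) 1
  · rw [Set.indicator_of_mem hξ]
    have := exp_neg_mul_Phi_le_one ν ht.le ξ
    have : 0 ≤ ‖ξ‖ * Real.exp (-t * Phi ν ξ) := by positivity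
    linarith
  · rw [Set.indicator_of_notMem hξ, zero_add]
    have h2 : 1 ≤ ‖ξ‖ := by
      rw [mem_closedBall_zero_iff, not_le] at hξ
      exact hξ.le
    exact le_mul_of_one_le_left (Real.exp_pos _).le h2

/-- On the ball `|ξ| ≤ 1/h(t)` one has `tΦ(ξ) ≤ tΨ(1/h(t)) = 1`. -/
lemma le_integral_exp (hA : CondA1 ν M₀ ∞) (hL : IsPsiConstant d L₀)
    (hν : IsSymmLevyMeasure ν) (ht : 0 < t) :
    Real.exp (-1) * ballVol d * (hFun ν t ^ d)⁻¹ ≤ ∫ ξ, Real.exp (-t * Phi ν ξ) := by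
  have hh := hFun_pos hL hν ht
  have hi := hA.integrable_exp hν.isSymLevy ht
  have h1 : volume.real (Metric.closedBall (0 : Rd d) (1 / hFun ν t)) • Real.exp (-1)
      ≤ ∫ ξ in Metric.closedBall (0 : Rd d) (1 / hFun ν t), Real.exp (-t * Phi ν ξ) := by
    refine setIntegral_ge_of_const_le Metric.isClosed_closedBall.measurableSet
      measure_closedBall_lt_top.ne (fun ξ hξ => ?_) hi.integrableOn
    rw [Real.exp_le_exp]
    have h2 := Phi_le_Psi hν.isSymLevy (mem_closedBall_zero_iff.1 hξ)
    rw [Psi_one_div_hFun hL hν ht, le_div_iff₀ ht] at h2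
    linarith
  rw [volume_real_closedBall _ (one_div_pos.2 hh), one_div, inv_pow, smul_eq_mul] at h1
  refine le_trans (le_of_eq (by ring)) (h1.trans (setIntegral_le_integral hi
    (Eventually.of_forall fun ξ => (Real.exp_pos _).le)))

/-- The integrand is at most `1` on the ball `|ξ| ≤ 1/h(t)`; outside it `1 ≤ h(t)|ξ|`, and (A1)
applies. -/
lemma integral_exp_le (hA : CondA1 ν M₀ ∞) (hM : 0 < M₀) (hL : IsPsiConstant d L₀)
    (hν : IsSymmLevyMeasure ν) (ht : 0 < t) :
    ∫ ξ, Real.exp (-t * Phi ν ξ) ≤ (ballVol d + M₀) * (hFun ν t ^ d)⁻¹ := by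
  have hh := hFun_pos hL hν ht
  have hi := hA.integrable_exp hν.isSymLevy ht
  have hi1 := hA.integrable_norm_mul hν.isSymLevy ht
  have hind : Integrable ((Metric.closedBall (0 : Rd d) (1 / hFun ν t)).indicator
      fun _ => (1 : ℝ)) :=
    (integrable_indicator_iff Metric.isClosed_closedBall.measurableSet).2
      (integrableOn_const (measure_closedBall_lt_top.ne))
  have h1 : ∫ ξ, Real.exp (-t * Phi ν ξ)
      ≤ ∫ ξ, ((Metric.closedBall (0 : Rd d) (1 / hFun ν t)).indicator (fun _ => (1 : ℝ)) ξ
        + hFun ν t * (‖ξ‖ * Real.exp (-t * Phi ν ξ))) := by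
    refine integral_mono hi (hind.add (hi1.const_mul _)) fun ξ => ?_
    by_cases hξ : ξ ∈ Metric.closedBall (0 : Rd d) (1 / hFun ν t)
    · simp only [Set.indicator_of_mem hξ]
      have := exp_neg_mul_Phi_le_one ν ht.le ξ
      have : 0 ≤ hFun ν t * (‖ξ‖ * Real.exp (-t * Phi ν ξ)) := by positivity
      linarith
    · simp only [Set.indicator_of_notMem hξ, zero_add]
      rw [mem_closedBall_zero_iff, not_le, div_lt_iff₀ hh] at hξ
      rw [← mul_assoc]
      exact le_mul_of_one_le_left (Real.exp_pos _).le (by linarith)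
  rw [integral_add hind (hi1.const_mul _), integral_const_mul,
    integral_indicator Metric.isClosed_closedBall.measurableSet] at h1
  have h2 : ∫ _ξ in Metric.closedBall (0 : Rd d) (1 / hFun ν t), (1 : ℝ)
      = (hFun ν t ^ d)⁻¹ * ballVol d := by
    rw [setIntegral_const, volume_real_closedBall _ (one_div_pos.2 hh), one_div, inv_pow]
    simp
  have h3 := mul_le_mul_of_nonneg_left (hA.integral_norm_mul_le hM hL hν ht) hh.le
  have h4 : hFun ν t * (M₀ * (hFun ν t ^ (d + 1))⁻¹) = M₀ * (hFun ν t ^ d)⁻¹ := by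
    field_simp
    ring
  rw [h2] at h1
  rw [h4] at h3
  linarith

/-- The height of the near-diagonal lower bound for a part of the Lévy measure. -/
def coreHeight (d : ℕ) : ℝ := Real.exp (-1) * ballVol d / 2

/-- The radius of the near-diagonal lower bound when jumps of intensity `Λ` are removed. -/
def coreRadius (d : ℕ) (M₀ Λ : ℝ) : ℝ := coreHeight d / M₀ * Real.exp (-(2 * Λ))

lemma coreHeight_pos (d : ℕ) : 0 < coreHeight d := by
  have := ballVol_pos d
  unfold coreHeight
  positivity

lemma coreRadius_pos (d : ℕ) (hM : 0 < M₀) (Λ : ℝ) : 0 < coreRadius d M₀ Λ := by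
  have := coreHeight_pos d
  unfold coreRadius
  positivity

variable {ν₁ ν₂ : Measure (Rd d)} [IsFiniteMeasure ν₂]

/-- Since `1 - cos ≤ 2`, the removed part contributes at most `2ν₂(ℝ^d)` to `Φ`. -/
lemma exp_Phi_left_le (hsum : ν = ν₁ + ν₂) (h₁ : IsSymLevy ν₁) (h₂ : ν₂.IsNegInvariant)
    (ht : 0 ≤ t) {Λ : ℝ} (hΛ : t * ν₂.real Set.univ ≤ Λ) (ξ : Rd d) :
    Real.exp (-t * Phi ν₁ ξ) ≤ Real.exp (2 * Λ) * Real.exp (-t * Phi ν ξ) := by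
  rw [← Real.exp_add, Real.exp_le_exp, hsum, Phi_add h₁ (isSymLevy_of_isFiniteMeasure h₂),
    Phi_of_isFiniteMeasure ν₂]
  have h3 := (abs_le.1 (abs_cosT_le ν₂ ξ)).1
  have h4 : t * (ν₂.real Set.univ - cosT ν₂ ξ) ≤ t * (2 * ν₂.real Set.univ) := by
    gcongr
    linarith
  nlinarith

lemma exp_Phi_le_left (hsum : ν = ν₁ + ν₂) (h₁ : IsSymLevy ν₁) (h₂ : ν₂.IsNegInvariant)
    (ht : 0 ≤ t) (ξ : Rd d) :
    Real.exp (-t * Phi ν ξ) ≤ Real.exp (-t * Phi ν₁ ξ) := by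
  rw [Real.exp_le_exp, hsum, Phi_add h₁ (isSymLevy_of_isFiniteMeasure h₂)]
  nlinarith [Phi_nonneg ν₂ ξ]

lemma integrable_exp_left (hA : CondA1 ν M₀ ∞) (h : IsSymLevy ν)
    (hsum : ν = ν₁ + ν₂) (h₁ : IsSymLevy ν₁) (h₂ : ν₂.IsNegInvariant) (ht : 0 < t) :
    Integrable fun ξ => Real.exp (-t * Phi ν₁ ξ) := by
  have hc := h₁.continuous_Phi
  refine ((hA.integrable_exp h ht).const_mul (Real.exp (2 * (t * ν₂.real Set.univ)))).mono'
    (by fun_prop : Continuous _).aestronglyMeasurable (Eventually.of_forall fun ξ => ?_)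
  rw [Real.norm_of_nonneg (Real.exp_pos _).le]
  exact exp_Phi_left_le hsum h₁ h₂ ht.le le_rfl ξ

/-- Near-diagonal lower bound after removing a finite part of the Lévy measure. -/
lemma core_lower_bound (hA : CondA1 ν M₀ ∞) (hM : 0 < M₀) (hL : IsPsiConstant d L₀)
    (hν : IsSymmLevyMeasure ν) (hsum : ν = ν₁ + ν₂) (h₁ : IsSymLevy ν₁)
    (h₂ : ν₂.IsNegInvariant) (ht : 0 < t) {Λ : ℝ} (hΛ : t * ν₂.real Set.univ ≤ Λ) {y : Rd d}
    (hy : ‖y‖ ≤ coreRadius d M₀ Λ * hFun ν t) :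
    coreHeight d * (hFun ν t ^ d)⁻¹ ≤ cosInt (fun ξ => Real.exp (-t * Phi ν₁ ξ)) y := by
  have hh := hFun_pos hL hν ht
  have hc := h₁.continuous_Phi
  have hi := hA.integrable_exp hν.isSymLevy ht
  have hi1 := integrable_exp_left hA hν.isSymLevy hsum h₁ h₂ ht
  have hin := hA.integrable_norm_mul hν.isSymLevy ht
  have hle : ∀ ξ : Rd d, ‖ξ‖ * |Real.exp (-t * Phi ν₁ ξ)|
      ≤ Real.exp (2 * Λ) * (‖ξ‖ * Real.exp (-t * Phi ν ξ)) := by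
    intro ξ
    rw [abs_of_pos (Real.exp_pos _), mul_left_comm]
    exact mul_le_mul_of_nonneg_left (exp_Phi_left_le hsum h₁ h₂ ht.le hΛ ξ) (norm_nonneg _)
  have hin1 : Integrable fun ξ : Rd d => ‖ξ‖ * |Real.exp (-t * Phi ν₁ ξ)| := by
    refine (hin.const_mul (Real.exp (2 * Λ))).mono'
      (by fun_prop : Continuous _).aestronglyMeasurable (Eventually.of_forall fun ξ => ?_)
    rw [Real.norm_of_nonneg (by positivity)]
    exact hle ξ
  have h3 := cosInt_sub_le hi1 hin1 y
  have h4 : ∫ ξ : Rd d, ‖ξ‖ * |Real.exp (-t * Phi ν₁ ξ)|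
      ≤ Real.exp (2 * Λ) * (M₀ * (hFun ν t ^ (d + 1))⁻¹) := by
    refine (integral_mono hin1 (hin.const_mul _) hle).trans ?_
    rw [integral_const_mul]
    exact mul_le_mul_of_nonneg_left (hA.integral_norm_mul_le hM hL hν ht) (Real.exp_pos _).le
  have h5 : 2 * (coreHeight d * (hFun ν t ^ d)⁻¹)
      ≤ cosInt (fun ξ => Real.exp (-t * Phi ν₁ ξ)) 0 := by
    refine le_trans (le_of_eq ?_) ((le_integral_exp hA hL hν ht).trans ?_)
    · unfold coreHeight
      ring
    · simp only [cosInt, inner_zero_left, Real.cos_zero, one_mul]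
      exact integral_mono hi hi1 fun ξ => exp_Phi_le_left hsum h₁ h₂ ht.le ξ
  -- `coreHeight` is half the constant of `le_integral_exp`, and `coreRadius` is chosen so that the
  -- Lipschitz loss uses up at most the other half.
  have h6 : ‖y‖ * ∫ ξ : Rd d, ‖ξ‖ * |Real.exp (-t * Phi ν₁ ξ)|
      ≤ coreHeight d * (hFun ν t ^ d)⁻¹ := by
    calc ‖y‖ * ∫ ξ : Rd d, ‖ξ‖ * |Real.exp (-t * Phi ν₁ ξ)|
        ≤ (coreRadius d M₀ Λ * hFun ν t) *
          (Real.exp (2 * Λ) * (M₀ * (hFun ν t ^ (d + 1))⁻¹)) :=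
          mul_le_mul hy h4 (integral_nonneg fun ξ => by positivity)
            (mul_nonneg (coreRadius_pos d hM Λ).le hh.le)
      _ = coreHeight d * (hFun ν t ^ d)⁻¹ * (Real.exp (-(2 * Λ)) * Real.exp (2 * Λ)) := by
          unfold coreRadius
          field_simp
          ring
      _ = _ := by rw [← Real.exp_add]; simp
  linarith

/-- The contribution of exactly `k` jumps from the finite part of the Lévy measure. -/
lemma density_ge_jumps (hA : CondA1 ν M₀ ∞) (h : IsSymLevy ν)
    {P : ℝ → Measure (Rd d)} {p : ℝ → Rd d → ℝ}
    (hP : IsLevySemigroup ν P) (hp : IsTransitionDensity P p)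
    (hsum : ν = ν₁ + ν₂) (h₁ : IsSymLevy ν₁)
    (h₂ : ν₂.IsNegInvariant) (ht : 0 < t) {Λ : ℝ} (hΛ : t * ν₂.real Set.univ ≤ Λ) (k : ℕ)
    (x : Rd d) :
    fourierConst d * (Real.exp (-Λ) * (t ^ k / k.factorial *
      cosInt (fun ξ => Real.exp (-t * Phi ν₁ ξ) * cosT ν₂ ξ ^ k) x)) ≤ p t x := by
  have hi1 := integrable_exp_left hA h hsum h₁ h₂ ht
  have h0 := h₁.cosInt_nonneg ht.le hi1
  have hsin := sinFree_of_isNegInvariant h₂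
  rw [transitionDensity_eq hP hp ht (hA.integrable_exp h ht)]
  refine mul_le_mul_of_nonneg_left ?_ (fourierConst_pos d).le
  -- The factor `e^{-tν₂(ℝ^d)}`, at least `e^{-Λ}`, is the probability of no jump from `ν₂`; the
  -- series is expanded in the last factor.
  have h3 : (fun ξ => Real.exp (-t * Phi ν ξ)) = fun ξ => Real.exp (-t * ν₂.real Set.univ) *
      (Real.exp (-t * Phi ν₁ ξ) * Real.exp (t * cosT ν₂ ξ)) := by
    funext ξ
    rw [hsum, Phi_add h₁ (isSymLevy_of_isFiniteMeasure h₂), mul_add, Real.exp_add,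
      exp_neg_mul_Phi_of_isFiniteMeasure ν₂]
    ring
  rw [h3, cosInt_const_mul]
  refine mul_le_mul (Real.exp_le_exp.2 (by linarith)) (cosInt_mul_exp_ge hi1 h0 hsin ht.le k x)
    (mul_nonneg (by positivity) (cosInt_mul_cosT_pow_nonneg hi1 h0 hsin k x)) (Real.exp_pos _).le

end CondA1

/-- The case `ν₂ = 0`, `Λ = 0` of the core bound; the upper bound is the `L¹` norm of `e^{-tΦ}`. -/
theorem exists_isThetaConstant {L₀ : ℝ} (hL : IsPsiConstant d L₀) {M₀ : ℝ} (hM : 0 < M₀) :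
    ∃ θ : ℝ, IsThetaConstant d M₀ θ := by
  have hω := ballVol_pos d
  have hf := fourierConst_pos d
  refine ⟨coreRadius d M₀ 0, coreRadius_pos d hM 0, fourierConst d * coreHeight d,
    fourierConst d * (ballVol d + M₀), mul_pos hf (coreHeight_pos d), by positivity, ?_⟩
  intro ν hν hA P p hP hp t x ht hx
  have hi := hA.integrable_exp hν.isSymLevy ht
  rw [transitionDensity_eq hP hp ht hi, mul_assoc, mul_assoc]
  have h0 : (0 : Measure (Rd d)).IsNegInvariant := ⟨by simp [Measure.neg]⟩
  refine ⟨mul_le_mul_of_nonneg_left ?_ hf.le, mul_le_mul_of_nonneg_left ?_ hf.le⟩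
  · exact core_lower_bound hA hM hL hν (ν₁ := ν) (ν₂ := 0) (by simp) hν.isSymLevy h0 ht
      (by simp) hx.le
  · refine (le_abs_self _).trans ((abs_cosInt_le hi x).trans ?_)
    simp only [abs_of_pos (Real.exp_pos _)]
    exact integral_exp_le hA hM hL hν ht

/-- The near-diagonal bound extends to the closed ball. -/
lemma near_diagonal_bound {L₀ : ℝ} (hL : IsPsiConstant d L₀) {ν : Measure (Rd d)}
    (hν : IsSymmLevyMeasure ν) {P : ℝ → Measure (Rd d)} {p : ℝ → Rd d → ℝ}
    (hp : IsTransitionDensity P p) {θ a : ℝ} {t : ℝ} (ht : 0 < t)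
    (hθ : 0 < θ) (hbound : ∀ x : Rd d, ‖x‖ < θ * hFun ν t → a ≤ p t x) {x : Rd d}
    (hx : ‖x‖ ≤ θ * hFun ν t) : a ≤ p t x := by
  have hr : θ * hFun ν t ≠ 0 := (mul_pos hθ (hFun_pos hL hν ht)).ne'
  have h1 : closure (Metric.ball (0 : Rd d) (θ * hFun ν t)) ⊆ {x | a ≤ p t x} :=
    closure_minimal (fun y hy => hbound y (by simpa using hy))
      (isClosed_le continuous_const (hp t ht).1)
  rw [closure_ball _ hr] at h1
  exact h1 (by simpa using hx)

/-! ### One large jump -/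

/-- The contribution of a single large jump. -/
lemma single_jump_bound {L₀ M₀ η : ℝ} (hL : IsPsiConstant d L₀) (hM : 0 < M₀) (hη : 0 < η)
    (hη1 : η ≤ 1) {ν : Measure (Rd d)} (hν : IsSymmLevyMeasure ν) (hA : CondA1 ν M₀ ∞)
    {P : ℝ → Measure (Rd d)} {p : ℝ → Rd d → ℝ}
    (hP : IsLevySemigroup ν P) (hp : IsTransitionDensity P p) {t : ℝ} (ht : 0 < t) {x : Rd d}
    (hx : η * hFun ν t ≤ ‖x‖) {c₂ : ℝ} (hc₂ : c₂ ≤ η / 2)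
    (hc₂' : c₂ ≤ coreRadius d M₀ (4 / (η ^ 2 * L₀))) :
    ENNReal.ofReal (fourierConst d * Real.exp (-(4 / (η ^ 2 * L₀))) * coreHeight d *
        (t * (hFun ν t ^ d)⁻¹)) * ν (Metric.ball x (c₂ * hFun ν t))
      ≤ ENNReal.ofReal (p t x) := by
  have hh := hFun_pos hL hν ht
  have h := hν.isSymLevy
  have hL0 := hL.1
  set h₀ := hFun ν t with hh₀
  -- The threshold `ηh/2` keeps the target ball inside `S`, because `|x| ≥ ηh` and `c₂ ≤ η/2`.
  set S : Set (Rd d) := {y | η / 2 * h₀ < ‖y‖} with hS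
  have hSm : MeasurableSet S := measurableSet_norm_gt _
  have hr : 0 < η / 2 * h₀ := by positivity
  have hfin : IsFiniteMeasure (ν.restrict S) := h.isFiniteMeasure_restrict hr
  have hsum : ν = ν.restrict Sᶜ + ν.restrict S := (Measure.restrict_compl_add_restrict hSm).symm
  have h₁ : IsSymLevy (ν.restrict Sᶜ) := h.restrict_norm_gt_compl _
  have h₂ : (ν.restrict S).IsNegInvariant := (h.restrict_norm_gt _).neg
  -- On `S` the integrand of `H(1/h)` is at least `(η/2)²`, and `tH(1/h) ≤ 1/L₀`.
  have hΛ : t * (ν.restrict S).real Set.univ ≤ 4 / (η ^ 2 * L₀) := by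
    have h3 : ν.real S • (η / 2) ^ 2 ≤ ∫ y in S, min 1 ((1 / h₀) ^ 2 * ‖y‖ ^ 2) ∂ν := by
      refine setIntegral_ge_of_const_le hSm (h.measure_norm_gt_lt_top hr).ne (fun y hy => ?_)
        (h.integrable_min_mul _).integrableOn
      have hy' : η / 2 * h₀ < ‖y‖ := hy
      refine le_min (pow_le_one₀ (by positivity) (by linarith)) ?_
      rw [← mul_pow]
      refine pow_le_pow_left₀ (by positivity) ?_ 2
      rw [one_div_mul_eq_div, le_div_iff₀ hh]
      exact hy'.le
    have h4 : ∫ y in S, min 1 ((1 / h₀) ^ 2 * ‖y‖ ^ 2) ∂ν ≤ HFun ν (1 / h₀) :=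
      setIntegral_le_integral (h.integrable_min_mul _) (Eventually.of_forall fun y => by positivity)
    have h5 := mul_HFun_le hL hν ht
    have h6 : t * (ν.real S * (η / 2) ^ 2) ≤ 1 / L₀ :=
      (mul_le_mul_of_nonneg_left (h3.trans h4) ht.le).trans h5
    rw [measureReal_restrict_apply_univ, le_div_iff₀ (by positivity)]
    rw [le_div_iff₀ hL0] at h6
    linarith
  have hden := density_ge_jumps hA h hP hp hsum h₁ h₂ ht hΛ 1 x
  have hi1 := integrable_exp_left hA h hsum h₁ h₂ ht
  have h0 := h₁.cosInt_nonneg ht.le hi1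
  have hball : Metric.ball x (c₂ * h₀) ⊆ S := by
    intro y hy
    rw [mem_ball_iff_norm] at hy
    have h7 := norm_sub_norm_le x y
    rw [norm_sub_rev] at h7
    have h8 : c₂ * h₀ ≤ η / 2 * h₀ := by gcongr
    change η / 2 * h₀ < ‖y‖
    linarith
  have hJ : coreHeight d * (h₀ ^ d)⁻¹ * ν.real (Metric.ball x (c₂ * h₀))
      ≤ cosInt (fun ξ => Real.exp (-t * Phi (ν.restrict Sᶜ) ξ) * cosT (ν.restrict S) ξ ^ 1) x := by
    simp only [pow_one]
    rw [cosInt_mul_cosT hi1 (sinFree_of_isNegInvariant h₂)]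
    have hint := integrable_cosInt_sub hi1 (ν.restrict S) x
    have h9 := setIntegral_ge_of_const_le (μ := ν.restrict S) (c := coreHeight d * (h₀ ^ d)⁻¹)
      (f := fun z => cosInt (fun ξ => Real.exp (-t * Phi (ν.restrict Sᶜ) ξ)) (x - z))
      (measurableSet_ball (x := x) (ε := c₂ * h₀)) (measure_lt_top _ _).ne (fun z hz => by
        refine core_lower_bound hA hM hL hν hsum h₁ h₂ ht hΛ ?_
        rw [mem_ball_iff_norm, norm_sub_rev] at hz
        exact hz.le.trans (by gcongr)) hint.integrableOn
    rw [measureReal_restrict_apply measurableSet_ball, Set.inter_eq_left.2 hball,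
      smul_eq_mul, mul_comm] at h9
    exact h9.trans (setIntegral_le_integral hint (Eventually.of_forall fun z => h0 _))
  have hνfin : ν (Metric.ball x (c₂ * h₀)) ≠ ∞ :=
    ((measure_mono hball).trans_lt (h.measure_norm_gt_lt_top hr)).ne
  rw [← ENNReal.ofReal_toReal hνfin, ← ENNReal.ofReal_mul (by
    have := fourierConst_pos d
    have := coreHeight_pos d
    positivity)]
  refine ENNReal.ofReal_le_ofReal (le_trans ?_ hden)
  simp only [pow_one, Nat.factorial_one, Nat.cast_one, div_one] at hJ ⊢
  rw [← measureReal_def]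
  have h10 : fourierConst d * (Real.exp (-(4 / (η ^ 2 * L₀))) * (t *
      (coreHeight d * (h₀ ^ d)⁻¹ * ν.real (Metric.ball x (c₂ * h₀)))))
      ≤ fourierConst d * (Real.exp (-(4 / (η ^ 2 * L₀))) * (t * cosInt (fun ξ =>
        Real.exp (-t * Phi (ν.restrict Sᶜ) ξ) * cosT (ν.restrict S) ξ) x)) := by
    have := fourierConst_pos d
    gcongr
  exact le_trans (le_of_eq (by ring)) h10

/-! ### Chaining -/

/-- Iterated convolution lower bound along a segment. -/
lemma chain_lower_bound {G : ℕ → Rd d → ℝ} {α A ρ : ℝ} (hα : 0 ≤ α) (hρ : 0 < ρ)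
    (hc : ∀ k, Continuous (G k)) (h0 : ∀ k x, 0 ≤ G k x)
    (hstep : ∀ k x, α * ∫ z in Metric.ball 0 ρ, G k (x - z) ≤ G (k + 1) x)
    (hbase : ∀ x, ‖x‖ ≤ 7 / 8 * ρ → A ≤ G 0 x) (k : ℕ) (x : Rd d)
    (hx : ‖x‖ ≤ 7 / 8 * ρ + 3 / 4 * ρ * k) :
    A * (α * ((ρ / 8) ^ d * ballVol d)) ^ k ≤ G k x := by
  have hω := ballVol_pos d
  induction k generalizing x with
  | zero => simpa using hbase x (by simpa using hx)
  | succ k ih =>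
    -- The point `z₀` splits `x` in the proportion of the two summands of `R`. Then `B(z₀, ρ/8) ⊆
    -- B(0, ρ)`, and for `z` in the small ball `|x - z|` is within the range of the induction
    -- hypothesis: the net gain per step is `7ρ/8 - ρ/8 = 3ρ/4`.
    set R : ℝ := 7 / 8 * ρ + 3 / 4 * ρ * ((k + 1 : ℕ) : ℝ) with hR
    have hRpos : 0 < R := by positivity
    set z₀ : Rd d := (7 / 8 * ρ / R) • x with hz₀
    have hz₀n : ‖z₀‖ ≤ 7 / 8 * ρ := by
      rw [hz₀, norm_smul, Real.norm_of_nonneg (by positivity), div_mul_eq_mul_div,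
        div_le_iff₀ hRpos]
      gcongr
    have hxz : ‖x - z₀‖ ≤ 3 / 4 * ρ * ((k + 1 : ℕ) : ℝ) := by
      have h1 : x - z₀ = (3 / 4 * ρ * ((k + 1 : ℕ) : ℝ) / R) • x := by
        have h2 : 3 / 4 * ρ * ((k + 1 : ℕ) : ℝ) / R = 1 - 7 / 8 * ρ / R := by
          rw [eq_sub_iff_add_eq, ← add_div, div_eq_one_iff_eq hRpos.ne', hR]
          ring
        rw [h2, sub_smul, one_smul]
      rw [h1, norm_smul, Real.norm_of_nonneg (by positivity), div_mul_eq_mul_div,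
        div_le_iff₀ hRpos]
      gcongr
    have hsub : Metric.ball z₀ (ρ / 8) ⊆ Metric.ball 0 ρ := by
      intro z hz
      rw [mem_ball_iff_norm] at hz
      rw [mem_ball_zero_iff]
      have := norm_le_norm_add_norm_sub' z z₀
      linarith
    have hcont : Continuous fun z => G k (x - z) := (hc k).comp (by fun_prop)
    have hint : IntegrableOn (fun z => G k (x - z)) (Metric.ball 0 ρ) :=
      (hcont.continuousOn.integrableOn_compact (isCompact_closedBall 0 ρ)).mono_set
        Metric.ball_subset_closedBall
    have h3 := setIntegral_ge_of_const_le (μ := (volume : Measure (Rd d)))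
      (c := A * (α * ((ρ / 8) ^ d * ballVol d)) ^ k) (f := fun z => G k (x - z))
      (measurableSet_ball (x := z₀) (ε := ρ / 8)) measure_ball_lt_top.ne (fun z hz => by
        refine ih (x - z) ?_
        rw [mem_ball_iff_norm, norm_sub_rev] at hz
        have h4 := norm_add_le (x - z₀) (z₀ - z)
        rw [sub_add_sub_cancel] at h4
        push_cast at hxz
        linarith) (hint.mono_set hsub)
    rw [volume_real_ball _ (by positivity : 0 < ρ / 8), smul_eq_mul] at h3
    have h5 : ∫ z in Metric.ball z₀ (ρ / 8), G k (x - z) ≤ ∫ z in Metric.ball 0 ρ, G k (x - z) :=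
      setIntegral_mono_set hint (Eventually.of_forall fun z => h0 k _) hsub.eventuallyLE
    calc A * (α * ((ρ / 8) ^ d * ballVol d)) ^ (k + 1)
        = α * ((ρ / 8) ^ d * ballVol d * (A * (α * ((ρ / 8) ^ d * ballVol d)) ^ k)) := by ring
      _ ≤ α * ∫ z in Metric.ball 0 ρ, G k (x - z) :=
          mul_le_mul_of_nonneg_left (h3.trans h5) hα
      _ ≤ _ := hstep k x

/-! ### Bounded support: `h(t)` against `√t` and the Gaussian regime -/

section SecondMoment

variable {ν : Measure (Rd d)} {L₀ M₀ r₀ t η : ℝ}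

lemma ae_norm_le_of_support (hs : ν.support ⊆ Metric.closedBall 0 r₀) :
    ∀ᵐ y ∂ν, ‖y‖ ≤ r₀ := by
  have h1 : ν ν.supportᶜ = 0 := Measure.measure_compl_support
  filter_upwards [compl_mem_ae_iff.2 h1] with y hy
  rw [compl_compl] at hy
  simpa using hs hy

lemma integrable_norm_sq (h : IsSymLevy ν) (hs : ν.support ⊆ Metric.closedBall 0 r₀) :
    Integrable (fun y => ‖y‖ ^ 2) ν := by
  refine (h.integrable_min.const_mul (1 + r₀ ^ 2)).mono' (by fun_prop) ?_
  filter_upwards [ae_norm_le_of_support hs] with y hy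
  rw [Real.norm_of_nonneg (by positivity)]
  have h1 : ‖y‖ ^ 2 ≤ r₀ ^ 2 := pow_le_pow_left₀ (norm_nonneg _) hy 2
  rcases le_total 1 (‖y‖ ^ 2) with h2 | h2
  · rw [min_eq_left h2]
    linarith
  · rw [min_eq_right h2]
    nlinarith [sq_nonneg ‖y‖, sq_nonneg r₀]

lemma secondMoment_pos (hν : IsSymmLevyMeasure ν) (hs : ν.support ⊆ Metric.closedBall 0 r₀) :
    0 < secondMoment ν := by
  have hi := integrable_norm_sq hν.isSymLevy hs
  refine (integral_nonneg fun y => by positivity).lt_of_ne fun h0 => ?_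
  have h1 := (integral_eq_zero_iff_of_nonneg (fun y => by positivity) hi).1 h0.symm
  have h2 : ν {0}ᶜ = 0 := by
    refine measure_mono_null (fun y hy => ?_) h1
    simpa using hy
  have h3 : ν Set.univ = 0 := by
    rw [← measure_add_measure_compl (measurableSet_singleton (0 : Rd d)), hν.zero, h2, add_zero]
  rw [hν.infinite] at h3
  exact ENNReal.top_ne_zero h3

lemma HFun_le (h : IsSymLevy ν) (hs : ν.support ⊆ Metric.closedBall 0 r₀) (r : ℝ) :
    HFun ν r ≤ r ^ 2 * secondMoment ν := by
  rw [secondMoment, ← integral_const_mul]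
  exact integral_mono (h.integrable_min_mul r) ((integrable_norm_sq h hs).const_mul _)
    fun y => min_le_right _ _

lemma HFun_eq (hs : ν.support ⊆ Metric.closedBall 0 r₀) {r : ℝ} (hr : 0 ≤ r)
    (hr0 : r * r₀ ≤ 1) : HFun ν r = r ^ 2 * secondMoment ν := by
  rw [secondMoment, ← integral_const_mul]
  refine integral_congr_ae ?_
  filter_upwards [ae_norm_le_of_support hs] with y hy
  refine min_eq_right ?_
  rw [← mul_pow]
  exact pow_le_one₀ (by positivity) (le_trans (by gcongr) hr0)

lemma hFun_sq_le (hL : IsPsiConstant d L₀) (hν : IsSymmLevyMeasure ν)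
    (hs : ν.support ⊆ Metric.closedBall 0 r₀) (ht : 0 < t) :
    hFun ν t ^ 2 ≤ 2 * secondMoment ν * t := by
  have hh := hFun_pos hL hν ht
  have h1 := (Psi_le_two_mul hν.isSymLevy (one_div_pos.2 hh).le).trans
    (mul_le_mul_of_nonneg_left (HFun_le hν.isSymLevy hs _) zero_le_two)
  rw [Psi_one_div_hFun hL hν ht, one_div_pow, one_div_mul_eq_div, ← mul_div_assoc,
    div_le_div_iff₀ ht (by positivity)] at h1
  linarith

/-- For such `t` one has `h(t) ≥ r₀`: otherwise `Ψ(1/r₀) ≤ 1/t`, while `Ψ(1/r₀) ≥ L₀m₀/r₀²`. At the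
argument `1/h(t)` the function `H` is then exactly quadratic. -/
lemma le_hFun_sq (hL : IsPsiConstant d L₀) (hν : IsSymmLevyMeasure ν) (hr₀ : 0 < r₀)
    (hs : ν.support ⊆ Metric.closedBall 0 r₀)
    (ht : r₀ ^ 2 / (L₀ * secondMoment ν) < t) :
    L₀ * secondMoment ν * t ≤ hFun ν t ^ 2 := by
  have hm := secondMoment_pos hν hs
  have hL0 := hL.1
  have ht0 : 0 < t := lt_of_le_of_lt (by positivity) ht
  have hh := hFun_pos hL hν ht0
  rw [div_lt_iff₀ (by positivity)] at ht
  have h1 : 1 / hFun ν t * r₀ ≤ 1 := by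
    by_contra! hcon
    have h2 : 1 / r₀ ≤ 1 / hFun ν t := by
      rw [div_le_iff₀ hr₀]
      exact hcon.le
    have h3 := Psi_mono hν.isSymLevy (one_div_pos.2 hr₀).le h2
    have h4 := (hL.2 ν hν _ (one_div_pos.2 hr₀)).1
    rw [HFun_eq hs (one_div_pos.2 hr₀).le (one_div_mul_cancel hr₀.ne').le] at h4
    rw [Psi_one_div_hFun hL hν ht0] at h3
    have h5 := h4.trans h3
    rw [one_div_pow, one_div_mul_eq_div, ← mul_div_assoc, div_le_div_iff₀ (by positivity) ht0] at h5
    linarith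
  have h6 := (hL.2 ν hν _ (one_div_pos.2 hh)).1
  rw [HFun_eq hs (one_div_pos.2 hh).le h1, Psi_one_div_hFun hL hν ht0, one_div_pow,
    one_div_mul_eq_div, ← mul_div_assoc, div_le_div_iff₀ (by positivity) ht0] at h6
  linarith

lemma sqrt_bounds_hFun (hL : IsPsiConstant d L₀) (hν : IsSymmLevyMeasure ν) (hr₀ : 0 < r₀)
    (hs : ν.support ⊆ Metric.closedBall 0 r₀)
    (ht : r₀ ^ 2 / (L₀ * secondMoment ν) < t) :
    Real.sqrt (L₀ * secondMoment ν) * Real.sqrt t ≤ hFun ν t ∧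
      hFun ν t ≤ Real.sqrt (2 * secondMoment ν) * Real.sqrt t := by
  have hm := secondMoment_pos hν hs
  have hL0 := hL.1
  have ht0 : 0 < t := lt_of_le_of_lt (by positivity) ht
  rw [← Real.sqrt_mul (by positivity), ← Real.sqrt_mul (by positivity)]
  exact ⟨Real.sqrt_le_iff.2 ⟨(hFun_pos hL hν ht0).le, le_hFun_sq hL hν hr₀ hs ht⟩,
    Real.le_sqrt_of_sq_le (hFun_sq_le hL hν hs ht0)⟩

/-- The chaining argument: a near-diagonal bound at time `s` propagates to time `(k + 1) s`. -/
lemma chain_density {P : ℝ → Measure (Rd d)} {p : ℝ → Rd d → ℝ}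
    (hP : IsLevySemigroup ν P) (hp : IsTransitionDensity P p)
    (hint : ∀ t : ℝ, 0 < t → Integrable fun ξ => Real.exp (-t * Phi ν ξ))
    {s α ρ : ℝ} (hs : 0 < s) (hα : 0 ≤ α) (hρ : 0 < ρ)
    (hbase : ∀ y : Rd d, ‖y‖ ≤ ρ → α ≤ p s y) (k : ℕ) {x : Rd d}
    (hx : ‖x‖ ≤ 7 / 8 * ρ + 3 / 4 * ρ * k) :
    α * (α * ((ρ / 8) ^ d * ballVol d)) ^ k ≤ p (((k : ℝ) + 1) * s) x := by
  have hks : ∀ k : ℕ, 0 < ((k : ℝ) + 1) * s := fun k => by positivity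
  refine chain_lower_bound (G := fun k => p (((k : ℝ) + 1) * s)) hα hρ
    (fun k => (hp _ (hks k)).1) (fun k => (hp _ (hks k)).2.1) (fun k x => ?_)
    (fun x hx => ?_) k x hx
  · have h1 : (((k + 1 : ℕ) : ℝ) + 1) * s = ((k : ℝ) + 1) * s + s := by
      push_cast
      ring
    simp only [h1]
    rw [transitionDensity_add hP hp hint hs (hks k) x, ← integral_const_mul]
    obtain ⟨hc, h0, hd⟩ := hp s hs
    have hfin : IsFiniteMeasure (volume.withDensity fun x => ENNReal.ofReal (p s x)) := by
      rw [← hd]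
      have := (hP s hs.le).1
      infer_instance
    have hps := integrable_of_isFiniteMeasure_withDensity hc h0 hfin
    have hcont : Continuous fun z => p (((k : ℝ) + 1) * s) (x - z) :=
      (hp _ (hks k)).1.comp (by fun_prop)
    have hbd : ∀ z, ‖p (((k : ℝ) + 1) * s) z‖ ≤ fourierConst d *
        ∫ ξ, |Real.exp (-(((k : ℝ) + 1) * s) * Phi ν ξ)| := by
      intro z
      rw [transitionDensity_eq hP hp (hks k) (hint _ (hks k)), norm_mul,
        Real.norm_of_nonneg (fourierConst_pos d).le]
      exact mul_le_mul_of_nonneg_left (abs_cosInt_le (hint _ (hks k)) z) (fourierConst_pos d).le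
    have hi : Integrable fun z => p (((k : ℝ) + 1) * s) (x - z) * p s z :=
      hps.bdd_mul hcont.aestronglyMeasurable (Eventually.of_forall fun z => hbd (x - z))
    have hnn : ∀ z, 0 ≤ p (((k : ℝ) + 1) * s) (x - z) := fun z => (hp _ (hks k)).2.1 _
    have hib : IntegrableOn (fun z => α * p (((k : ℝ) + 1) * s) (x - z)) (Metric.ball 0 ρ) :=
      (((hcont.const_mul α).continuousOn).integrableOn_compact
        (isCompact_closedBall 0 ρ)).mono_set Metric.ball_subset_closedBall
    refine le_trans (setIntegral_mono_on hib hi.integrableOn measurableSet_ball fun z hz => ?_)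
      (setIntegral_le_integral hi (Eventually.of_forall fun z => mul_nonneg (hnn z) (h0 z)))
    rw [mul_comm]
    exact mul_le_mul_of_nonneg_left (hbase z (by simpa using (mem_ball_zero_iff.1 hz).le)) (hnn z)
  · simp only [Nat.cast_zero, zero_add, one_mul]
    exact hbase x (hx.trans (by linarith))

/-- The rate of the Gaussian lower bound. -/
def chainRate (d : ℕ) (a η : ℝ) : ℝ := |Real.log (a * ((η / 8) ^ d * ballVol d))| + 1

lemma chainRate_pos (d : ℕ) (a η : ℝ) : 0 < chainRate d a η := by
  unfold chainRate
  positivity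

/-- The right-hand side is the cost of one chaining step at radius `ηh` and height `ah^{-d}`: the
powers of `h` cancel. The absolute value and the `+ 1` in the rate keep it positive. -/
lemma exp_neg_chainRate_le {a η : ℝ} (ha : 0 < a) (hη : 0 < η) :
    Real.exp (-chainRate d a η) ≤ a * ((η / 8) ^ d * ballVol d) := by
  have := ballVol_pos d
  have hq : 0 < a * ((η / 8) ^ d * ballVol d) := by positivity
  rw [← Real.le_log_iff_exp_le hq, chainRate]
  linarith [neg_abs_le (Real.log (a * ((η / 8) ^ d * ballVol d)))]

/-- Chaining over `k + 1 = ⌈4A⌉` equal time steps with `A = |x|²/(η²L₀m₀t)`. Each step costs a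
constant factor, so the product is Gaussian in `x`. -/
lemma gaussian_bound {a : ℝ} (ha : 0 < a) (hη : 0 < η) (hη1 : η ≤ 1)
    (hL : IsPsiConstant d L₀) (hν : IsSymmLevyMeasure ν) (hA : CondA1 ν M₀ ∞) (hr₀ : 0 < r₀)
    (hs : ν.support ⊆ Metric.closedBall 0 r₀)
    {P : ℝ → Measure (Rd d)} {p : ℝ → Rd d → ℝ}
    (hP : IsLevySemigroup ν P) (hp : IsTransitionDensity P p)
    (hdiag : ∀ (s : ℝ) (y : Rd d), 0 < s → ‖y‖ ≤ η * hFun ν s → a * (hFun ν s ^ d)⁻¹ ≤ p s y)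
    {x : Rd d} (hx1 : η * hFun ν t ≤ ‖x‖) (hx2 : ‖x‖ ≤ η * L₀ * secondMoment ν / (4 * r₀) * t)
    (ht : 4 * r₀ ^ 2 / (η * L₀ * secondMoment ν) ≤ t) :
    a * ((hFun ν t ^ d)⁻¹ * Real.exp (-(5 * chainRate d a η / (η ^ 2 * L₀) * ‖x‖ ^ 2 /
      (secondMoment ν * t)))) ≤ p t x := by
  have hL0 := hL.1
  have hm := secondMoment_pos hν hs
  have ht0 : 0 < t := lt_of_lt_of_le (by positivity) ht
  have hω := ballVol_pos d
  have hCR := chainRate_pos d a η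
  set B : ℝ := L₀ * secondMoment ν * t with hB
  have hB0 : 0 < B := by positivity
  have hηB : 4 * r₀ ^ 2 ≤ η * B := by
    rw [div_le_iff₀ (by positivity)] at ht
    rw [hB]
    linarith
  have hB4 : 4 * r₀ ^ 2 ≤ B := hηB.trans (mul_le_of_le_one_left hB0.le hη1)
  have hr2 : 0 < r₀ ^ 2 := by positivity
  have hlarge : ∀ n : ℝ, 0 < n → n * r₀ ^ 2 < B → B / n ≤ hFun ν (t / n) ^ 2 := by
    intro n hn hnB
    have h1 : r₀ ^ 2 / (L₀ * secondMoment ν) < t / n := by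
      rw [div_lt_div_iff₀ (by positivity) hn]
      rw [hB] at hnB
      linarith
    have h2 := le_hFun_sq hL hν hr₀ hs h1
    rwa [← mul_div_assoc] at h2
  have hhB : B ≤ hFun ν t ^ 2 := by
    have := hlarge 1 one_pos (by linarith)
    simpa using this
  set A : ℝ := ‖x‖ ^ 2 / (η ^ 2 * B) with hAdef
  have hAx : ‖x‖ ^ 2 = A * (η ^ 2 * B) := by
    rw [hAdef, div_mul_cancel₀]
    positivity
  have hA1 : 1 ≤ A := by
    rw [hAdef, one_le_div (by positivity)]
    have h1 : (η * hFun ν t) ^ 2 ≤ ‖x‖ ^ 2 :=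
      pow_le_pow_left₀ (mul_nonneg hη.le (hFun_pos hL hν ht0).le) hx1 2
    rw [mul_pow] at h1
    exact (mul_le_mul_of_nonneg_left hhB (by positivity)).trans h1
  -- This is the restriction `|x| ≤ C_* t`; it keeps each time step above `r₀²/(L₀m₀)`, where `h(s)²
  -- ≥ L₀m₀s`.
  have hAB : 16 * A * r₀ ^ 2 ≤ B := by
    have h1 : ‖x‖ * (4 * r₀) ≤ η * B := by
      have h2 : ‖x‖ * (4 * r₀) ≤ η * L₀ * secondMoment ν / (4 * r₀) * t * (4 * r₀) := by gcongr
      refine h2.trans (le_of_eq ?_)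
      rw [hB]
      field_simp
    have h3 : (‖x‖ * (4 * r₀)) ^ 2 ≤ (η * B) ^ 2 := pow_le_pow_left₀ (by positivity) h1 2
    rw [mul_pow, hAx] at h3
    have h4 : (16 * A * r₀ ^ 2) * (η ^ 2 * B) ≤ B * (η ^ 2 * B) := by nlinarith
    exact le_of_mul_le_mul_right h4 (by positivity)
  obtain ⟨k, hk⟩ : ∃ k : ℕ, ⌈4 * A⌉₊ = k + 1 :=
    Nat.exists_eq_succ_of_ne_zero (Nat.ceil_pos.2 (by linarith)).ne'
  have hn1 : 4 * A ≤ (k : ℝ) + 1 := by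
    have := Nat.le_ceil (4 * A)
    rw [hk] at this
    exact_mod_cast this
  have hn2 : (k : ℝ) + 1 < 4 * A + 1 := by
    have := Nat.ceil_lt_add_one (a := 4 * A) (by linarith)
    rw [hk] at this
    exact_mod_cast this
  have hn0 : 0 < (k : ℝ) + 1 := by positivity
  -- The number of steps is below `4A + 1 ≤ 5A`, and `5Ar₀² < 16Ar₀² ≤ B`.
  have hnB : ((k : ℝ) + 1) * r₀ ^ 2 < B := by nlinarith
  set s : ℝ := t / ((k : ℝ) + 1) with hsdef
  have hs0 : 0 < s := by positivity
  have hh := hFun_pos hL hν hs0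
  have hst : s ≤ t := div_le_self ht0.le (by linarith [Nat.cast_nonneg (α := ℝ) k])
  have hhs : B ≤ ((k : ℝ) + 1) * hFun ν s ^ 2 := by
    have := hlarge _ hn0 hnB
    rw [div_le_iff₀ hn0] at this
    linarith
  have hxn : ‖x‖ ≤ 3 / 4 * ((k : ℝ) + 1) * (η * hFun ν s) := by
    refine (pow_le_pow_iff_left₀ (norm_nonneg _) (by positivity) two_ne_zero).1 ?_
    calc ‖x‖ ^ 2 = A * (η ^ 2 * B) := hAx
      _ ≤ (((k : ℝ) + 1) / 4) * (η ^ 2 * (((k : ℝ) + 1) * hFun ν s ^ 2)) := by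
          gcongr
          linarith
      _ ≤ (3 / 4 * ((k : ℝ) + 1) * (η * hFun ν s)) ^ 2 := by
          have : 0 ≤ (((k : ℝ) + 1) * (η * hFun ν s)) ^ 2 := by positivity
          nlinarith
  have hchain := chain_density hP hp (fun t ht => hA.integrable_exp hν.isSymLevy ht)
    hs0 (α := a * (hFun ν s ^ d)⁻¹) (ρ := η * hFun ν s) (by positivity) (by positivity)
    (fun y hy => hdiag s y hs0 hy) k (x := x) (by
      have : 0 < η * hFun ν s := by positivity
      nlinarith)
  have hkt : ((k : ℝ) + 1) * s = t := by
    rw [hsdef]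
    field_simp
  have hq : a * (hFun ν s ^ d)⁻¹ * ((η * hFun ν s / 8) ^ d * ballVol d)
      = a * ((η / 8) ^ d * ballVol d) := by
    rw [mul_div_right_comm, mul_pow]
    field_simp
  rw [hkt, hq] at hchain
  refine le_trans ?_ hchain
  rw [mul_assoc]
  refine mul_le_mul_of_nonneg_left ?_ ha.le
  refine mul_le_mul ?_ ?_ (Real.exp_pos _).le (by positivity)
  · have := hFun_mono hL hν hs0 hst
    gcongr
  · calc Real.exp (-(5 * chainRate d a η / (η ^ 2 * L₀) * ‖x‖ ^ 2 / (secondMoment ν * t)))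
        = Real.exp (-(chainRate d a η * (5 * A))) := by
          congr 2
          rw [hAdef, hB]
          field_simp
      -- Here `k < 4A ≤ 5A`, whence the `5` in the Gaussian constant.
      _ ≤ Real.exp (k * -chainRate d a η) := by
          rw [Real.exp_le_exp]
          nlinarith
      _ = Real.exp (-chainRate d a η) ^ k := Real.exp_nat_mul _ _
      _ ≤ _ := pow_le_pow_left₀ (Real.exp_pos _).le (exp_neg_chainRate_le ha hη) k

end SecondMoment

/-! ### The uniform part of `ν` and the regime of many jumps -/

section UniformPart

variable {ν : Measure (Rd d)} {L₀ M₀ r₀ κ₀ t η : ℝ}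

/-- The uniform part `κ₀ dx` on the ball of radius `r₀`. -/
def uniformPart (d : ℕ) (κ₀ r₀ : ℝ) : Measure (Rd d) :=
  ENNReal.ofReal κ₀ • volume.restrict (Metric.ball 0 r₀)

instance (κ₀ r₀ : ℝ) : IsFiniteMeasure (uniformPart d κ₀ r₀) := by
  have : IsFiniteMeasure ((volume : Measure (Rd d)).restrict (Metric.ball 0 r₀)) :=
    ⟨by simpa using measure_ball_lt_top⟩
  exact Measure.smul_finite _ ENNReal.ofReal_ne_top

lemma uniformPart_real_univ (hκ : 0 < κ₀) (hr₀ : 0 < r₀) :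
    (uniformPart d κ₀ r₀).real Set.univ = κ₀ * (r₀ ^ d * ballVol d) := by
  rw [uniformPart, measureReal_ennreal_smul_apply, measureReal_restrict_apply_univ,
    volume_real_ball _ hr₀, ENNReal.toReal_ofReal hκ.le]

lemma integral_uniformPart (hκ : 0 < κ₀) (f : Rd d → ℝ) :
    ∫ z, f z ∂(uniformPart d κ₀ r₀) = κ₀ * ∫ z in Metric.ball 0 r₀, f z := by
  rw [uniformPart, integral_smul_measure, ENNReal.toReal_ofReal hκ.le, smul_eq_mul]

lemma uniformPart_isNegInvariant : (uniformPart d κ₀ r₀).IsNegInvariant := by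
  have h : ((volume : Measure (Rd d)).restrict (Metric.ball 0 r₀)).IsNegInvariant :=
    isNegInvariant_restrict inferInstance measurableSet_ball fun y => by simp
  constructor
  rw [uniformPart, Measure.neg, Measure.map_smul]
  congr 1
  exact h.neg_eq_self

/-- The density of `ν_c` is almost everywhere at least its essential infimum, and the origin is a
null set because `d ≥ 1`. -/
lemma uniformPart_le (hd : 0 < d) (hk : ENNReal.ofReal κ₀ = kappa ν r₀) :
    uniformPart d κ₀ r₀ ≤ ν := by
  have : Nonempty (Fin d) := ⟨⟨0, hd⟩⟩
  refine le_trans ?_ (Measure.withDensity_rnDeriv_le ν volume)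
  have h1 : ∀ᵐ y ∂(volume.restrict {x : Rd d | 0 < ‖x‖ ∧ ‖x‖ < r₀}),
      ENNReal.ofReal κ₀ ≤ ν.rnDeriv volume y := by
    rw [hk]
    exact ae_essInf_le
  have h2 : (Metric.ball (0 : Rd d) r₀) =ᵐ[volume] {x : Rd d | 0 < ‖x‖ ∧ ‖x‖ < r₀} := by
    have h3 : ∀ᵐ y : Rd d, y ≠ 0 := by
      simp [ae_iff]
    filter_upwards [h3] with y hy
    refine propext ?_
    change y ∈ Metric.ball 0 r₀ ↔ (0 < ‖y‖ ∧ ‖y‖ < r₀)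
    simp [hy]
  rw [← Measure.restrict_congr_set h2] at h1
  rw [uniformPart, ← withDensity_const]
  exact (withDensity_mono h1).trans ((restrict_withDensity measurableSet_ball _).symm.le.trans
    Measure.restrict_le_self)

lemma isNegInvariant_sub (h : ν.IsNegInvariant) {μ : Measure (Rd d)} [IsFiniteMeasure μ]
    (hμ : μ.IsNegInvariant) (hle : μ ≤ ν) : (ν - μ).IsNegInvariant := by
  constructor
  ext D hD
  have h1 : ∀ ρ : Measure (Rd d), ρ.IsNegInvariant → ρ ((fun y => -y) ⁻¹' D) = ρ D := by
    intro ρ hρ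
    conv_rhs => rw [← hρ.neg_eq_self, Measure.neg, Measure.map_apply measurable_neg hD]
  rw [Measure.neg, Measure.map_apply measurable_neg hD, Measure.sub_apply hD hle]
  change (ν - μ) ((fun y => -y) ⁻¹' D) = _
  rw [Measure.sub_apply (measurable_neg hD) hle, h1 ν h, h1 μ hμ]

/-- The second moment dominates that of the uniform part. -/
lemma le_secondMoment (hd : 0 < d) (hν : IsSymmLevyMeasure ν) (hr₀ : 0 < r₀) (hκ : 0 < κ₀)
    (hs : ν.support ⊆ Metric.closedBall 0 r₀) (hk : ENNReal.ofReal κ₀ = kappa ν r₀) :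
    κ₀ * ((r₀ / 8) ^ d * ballVol d) * (r₀ / 2) ^ 2 ≤ secondMoment ν := by
  -- The ball of radius `r₀/8` about this point lies in the annulus `r₀/2 < |y| < r₀`.
  set z₀ : Rd d := (3 / 4 * r₀) • EuclideanSpace.single ⟨0, hd⟩ (1 : ℝ) with hz₀
  have hz₀n : ‖z₀‖ = 3 / 4 * r₀ := by
    rw [hz₀, norm_smul, PiLp.norm_single, Real.norm_of_nonneg (by positivity)]
    simp
  have hnorm : ∀ y ∈ Metric.ball z₀ (r₀ / 8), r₀ / 2 < ‖y‖ ∧ ‖y‖ < r₀ := by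
    intro y hy
    rw [mem_ball_iff_norm] at hy
    have h1 := norm_le_norm_add_norm_sub' y z₀
    have h2 := norm_le_norm_add_norm_sub' z₀ y
    rw [norm_sub_rev] at h2
    constructor <;> linarith
  have hfin : ν (Metric.ball z₀ (r₀ / 8)) ≠ ∞ :=
    ((measure_mono fun y hy => (hnorm y hy).1).trans_lt
      (hν.isSymLevy.measure_norm_gt_lt_top (by positivity : 0 < r₀ / 2))).ne
  have hi := integrable_norm_sq hν.isSymLevy hs
  have h3 : κ₀ * ((r₀ / 8) ^ d * ballVol d) ≤ ν.real (Metric.ball z₀ (r₀ / 8)) := by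
    have h4 : (uniformPart d κ₀ r₀).real (Metric.ball z₀ (r₀ / 8))
        = κ₀ * ((r₀ / 8) ^ d * ballVol d) := by
      rw [uniformPart, measureReal_ennreal_smul_apply, measureReal_restrict_apply
        measurableSet_ball, Set.inter_eq_left.2 fun y hy => by simpa using (hnorm y hy).2,
        volume_real_ball _ (by positivity), ENNReal.toReal_ofReal hκ.le]
    rw [← h4]
    exact ENNReal.toReal_mono hfin (uniformPart_le hd hk _)
  have h5 := setIntegral_ge_of_const_le (c := (r₀ / 2) ^ 2) (f := fun y : Rd d => ‖y‖ ^ 2)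
    measurableSet_ball hfin (fun y hy =>
      pow_le_pow_left₀ (by positivity) (hnorm y hy).1.le 2) hi.integrableOn
  rw [smul_eq_mul] at h5
  calc κ₀ * ((r₀ / 8) ^ d * ballVol d) * (r₀ / 2) ^ 2
      ≤ ν.real (Metric.ball z₀ (r₀ / 8)) * (r₀ / 2) ^ 2 := by gcongr
    _ ≤ ∫ y in Metric.ball z₀ (r₀ / 8), ‖y‖ ^ 2 ∂ν := h5
    _ ≤ _ := setIntegral_le_integral hi (Eventually.of_forall fun y => by positivity)

/-- Stirling-type bound for the weight of `n` jumps. -/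
lemma exp_neg_log_le_jump_weight {u τ v K C c : ℝ} {n : ℕ} (hu : 0 < u) (hn1 : u ≤ n)
    (hn2 : n ≤ 2 * u) (hτ : 0 < τ) (hv : 0 < v) (hτu : τ ≤ K * u) (hC : 0 ≤ C)
    (hcK : K ≤ c) (hcv : 2 / v * Real.exp C ≤ c) :
    Real.exp (-(2 * u * Real.log (c * u / τ))) ≤ Real.exp (-(C * u)) *
      ((τ * v) ^ n / n.factorial) := by
  have hc : 0 < c := lt_of_lt_of_le (by positivity) hcv
  have hn0 : (0 : ℝ) < n := hu.trans_le hn1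
  set ℓ := Real.log (c * u / τ) with hℓ
  have hℓ0 : 0 ≤ ℓ := by
    refine Real.log_nonneg ((one_le_div hτ).2 (hτu.trans ?_))
    gcongr
  have hexpℓ : Real.exp ℓ = c * u / τ := Real.exp_log (by positivity)
  -- The choice `c ≥ 2e^C/v` makes each of the `n` factors carry a surplus `e^C`; since `n ≥ u` the
  -- surplus pays for `e^{-Cu}`. The bound `n ≤ 2u` yields the `2` in the exponent, using `ℓ ≥ 0`,
  -- which follows from `c ≥ K`.
  have h1 : Real.exp (C - ℓ) ≤ τ * v / n := by
    rw [Real.exp_sub, hexpℓ, div_div_eq_mul_div, div_le_div_iff₀ (by positivity) hn0]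
    rw [div_mul_eq_mul_div, div_le_iff₀ hv] at hcv
    calc Real.exp C * τ * n ≤ Real.exp C * τ * (2 * u) := by gcongr
      _ = (2 * Real.exp C) * (τ * u) := by ring
      _ ≤ (c * v) * (τ * u) := by gcongr
      _ = τ * v * (c * u) := by ring
  have h2 : (τ * v / n) ^ n ≤ (τ * v) ^ n / n.factorial := by
    rw [div_pow]
    have h3 : (n.factorial : ℝ) ≤ (n : ℝ) ^ n := by exact_mod_cast Nat.factorial_le_pow n
    gcongr
  calc Real.exp (-(2 * u * ℓ)) ≤ Real.exp (-(C * u)) * Real.exp (n * (C - ℓ)) := by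
        rw [← Real.exp_add, Real.exp_le_exp]
        nlinarith [mul_le_mul_of_nonneg_right hn1 hC, mul_le_mul_of_nonneg_right hn2 hℓ0]
    _ ≤ Real.exp (-(C * u)) * ((τ * v) ^ n / n.factorial) := by
        rw [Real.exp_nat_mul]
        refine mul_le_mul_of_nonneg_left ((pow_le_pow_left₀ (Real.exp_pos _).le h1 n).trans h2)
          (Real.exp_pos _).le

/-- The contribution of `k + 1` jumps from the uniform part. -/
lemma uniform_jumps_bound (hd : 0 < d) (hM : 0 < M₀) (hL : IsPsiConstant d L₀)
    (hν : IsSymmLevyMeasure ν) (hA : CondA1 ν M₀ ∞) (hr₀ : 0 < r₀) (hκ : 0 < κ₀)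
    (hk : ENNReal.ofReal κ₀ = kappa ν r₀)
    {P : ℝ → Measure (Rd d)} {p : ℝ → Rd d → ℝ}
    (hP : IsLevySemigroup ν P) (hp : IsTransitionDensity P p) (ht : 0 < t) {Λ δ : ℝ}
    (hΛ : t * (κ₀ * (r₀ ^ d * ballVol d)) ≤ Λ) (hδ : 0 < δ) (hδ1 : δ ≤ r₀ / 8)
    (hδ2 : δ ≤ coreRadius d M₀ Λ * hFun ν t) (k : ℕ) {x : Rd d}
    (hx : ‖x‖ ≤ 7 / 8 * r₀ + 3 / 4 * r₀ * k) :
    fourierConst d * (Real.exp (-Λ) * (t ^ (k + 1) / (k + 1).factorial *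
      (κ₀ * (δ ^ d * ballVol d * (coreHeight d * (hFun ν t ^ d)⁻¹)) *
        (κ₀ * ((r₀ / 8) ^ d * ballVol d)) ^ k))) ≤ p t x := by
  have h := hν.isSymLevy
  have hle := uniformPart_le hd hk
  have hneg : (uniformPart d κ₀ r₀).IsNegInvariant := uniformPart_isNegInvariant
  have hsum : ν = (ν - uniformPart d κ₀ r₀) + uniformPart d κ₀ r₀ :=
    (Measure.sub_add_cancel_of_le hle).symm
  have h₁ : IsSymLevy (ν - uniformPart d κ₀ r₀) :=
    h.mono Measure.sub_le (isNegInvariant_sub h.neg hneg hle)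
  have hΛ' : t * (uniformPart d κ₀ r₀).real Set.univ ≤ Λ := by
    rwa [uniformPart_real_univ hκ hr₀]
  have hi1 := integrable_exp_left hA h hsum h₁ hneg ht
  have h0 := h₁.cosInt_nonneg ht.le hi1
  have hsin := sinFree_of_isNegInvariant hneg
  have hf := fourierConst_pos d
  refine le_trans ?_ (density_ge_jumps hA h hP hp hsum h₁ hneg ht hΛ' (k + 1) x)
  -- The chain starts with one jump already made: that jump spreads the core bound, valid only on a
  -- ball of radius `δ`, over the ball of radius `7r₀/8`.
  have hchain := chain_lower_bound (G := fun k => cosInt (fun ξ =>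
      Real.exp (-t * Phi (ν - uniformPart d κ₀ r₀) ξ) * cosT (uniformPart d κ₀ r₀) ξ ^ (k + 1)))
    (α := κ₀) (A := κ₀ * (δ ^ d * ballVol d * (coreHeight d * (hFun ν t ^ d)⁻¹))) (ρ := r₀)
    hκ.le hr₀ (fun k => continuous_cosInt (integrable_mul_cosT_pow hi1 _ _))
    (fun k x => cosInt_mul_cosT_pow_nonneg hi1 h0 hsin _ x) (fun k x => ?_) (fun x hx => ?_) k x hx
  · gcongr
  · rw [cosInt_mul_cosT_pow_succ hi1 hsin (k + 1) x, integral_uniformPart hκ]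
  · rw [cosInt_mul_cosT_pow_succ hi1 hsin 0 x, integral_uniformPart hκ]
    refine mul_le_mul_of_nonneg_left ?_ hκ.le
    simp only [pow_zero, mul_one]
    have hcont : Continuous fun z => cosInt (fun ξ =>
        Real.exp (-t * Phi (ν - uniformPart d κ₀ r₀) ξ)) (x - z) :=
      (continuous_cosInt hi1).comp (by fun_prop)
    have hint : IntegrableOn (fun z => cosInt (fun ξ =>
        Real.exp (-t * Phi (ν - uniformPart d κ₀ r₀) ξ)) (x - z)) (Metric.ball 0 r₀) :=
      (hcont.continuousOn.integrableOn_compact (isCompact_closedBall 0 r₀)).mono_set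
        Metric.ball_subset_closedBall
    have hsub : Metric.ball x δ ⊆ Metric.ball 0 r₀ := by
      intro z hz
      rw [mem_ball_iff_norm] at hz
      rw [mem_ball_zero_iff]
      have := norm_le_norm_add_norm_sub' z x
      linarith
    have h3 := setIntegral_ge_of_const_le (μ := (volume : Measure (Rd d)))
      (c := coreHeight d * (hFun ν t ^ d)⁻¹) (f := fun z => cosInt (fun ξ =>
        Real.exp (-t * Phi (ν - uniformPart d κ₀ r₀) ξ)) (x - z))
      (measurableSet_ball (x := x) (ε := δ)) measure_ball_lt_top.ne (fun z hz => by
        refine core_lower_bound hA hM hL hν hsum h₁ hneg ht hΛ' ?_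
        rw [mem_ball_iff_norm, norm_sub_rev] at hz
        exact hz.le.trans hδ2) (hint.mono_set hsub)
    rw [volume_real_ball _ hδ, smul_eq_mul] at h3
    exact h3.trans (setIntegral_mono_set hint (Eventually.of_forall fun z => h0 _)
      hsub.eventuallyLE)

/-- Only `k` of the `k + 1` jumps carry a factor `κ₀r₀^d v`, which leaves `r₀^{-d}`; the `h^d`
inside `δ^d` (here `q`) cancels the `h^{-d}` of the core bound. -/
lemma jump_weight_algebra {f H w e v R E₁ E₂ κ t F q : ℝ} (hR : R ≠ 0) (hv : v ≠ 0)
    (hq : q ≠ 0) (k : ℕ) :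
    f * (H * w * e / v) * (R⁻¹ * (E₁ * E₂ * ((κ * t * R * v) ^ (k + 1) / F)))
      = f * (E₁ * (t ^ (k + 1) / F * (κ * (e * E₂ * q * w * (H * q⁻¹)) * (κ * (R * v)) ^ k))) := by
  have h1 : q * q⁻¹ = 1 := mul_inv_cancel₀ hq
  have h2 : R * R⁻¹ = 1 := mul_inv_cancel₀ hR
  have h3 : v * v⁻¹ = 1 := mul_inv_cancel₀ hv
  have h4 : (κ * t * R * v) ^ (k + 1) = t ^ (k + 1) * (κ * (R * v)) ^ k * κ * (R * v) := by
    rw [show κ * t * R * v = t * (κ * (R * v)) by ring, mul_pow, pow_succ (κ * (R * v))]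
    ring
  rw [h4]
  calc _ = f * H * w * e * E₁ * E₂ * t ^ (k + 1) * (κ * (R * v)) ^ k * κ / F
        * ((R * R⁻¹) * (v * v⁻¹)) := by ring
    _ = f * H * w * e * E₁ * E₂ * t ^ (k + 1) * (κ * (R * v)) ^ k * κ / F * (q * q⁻¹) := by
        rw [h1, h2, h3, one_mul]
    _ = _ := by ring

/-- Lower bound far away from the origin, with explicit constants. -/
lemma exists_far_bound (hd : 0 < d) (hM : 0 < M₀) (hL : IsPsiConstant d L₀) (hη : 0 < η) :
    ∃ c₁ c₄ : ℝ, 0 < c₁ ∧ 0 < c₄ ∧ ∀ ν : Measure (Rd d), IsSymmLevyMeasure ν →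
      CondA1 ν M₀ ∞ → ∀ r₀ κ₀ : ℝ, 0 < r₀ → 0 < κ₀ →
      ν.support ⊆ Metric.closedBall 0 r₀ → ENNReal.ofReal κ₀ = kappa ν r₀ →
      ∀ (P : ℝ → Measure (Rd d)) (p : ℝ → Rd d → ℝ),
      IsLevySemigroup ν P → IsTransitionDensity P p → ∀ (t : ℝ) (x : Rd d), 0 < t →
      max r₀ (η * L₀ * secondMoment ν / (4 * r₀) * t) ≤ ‖x‖ →
      c₁ * ((r₀ ^ d)⁻¹ * Real.exp (-(2 * ‖x‖ / r₀ *
        Real.log (c₄ * ‖x‖ / (r₀ ^ (d + 1) * κ₀ * t))))) ≤ p t x := by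
  have hω := ballVol_pos d
  have hL0 := hL.1
  have hcH := coreHeight_pos d
  have hf := fourierConst_pos d
  set v : ℝ := ballVol d / 8 ^ d with hv
  have hv0 : 0 < v := by positivity
  set K₁ : ℝ := 16 / (η * L₀ * v) with hK₁
  set K₂ : ℝ := ballVol d * K₁ with hK₂
  set K₃ : ℝ := 8 / (η * L₀) with hK₃
  set ε : ℝ := min (coreHeight d / M₀) (1 / 8) with hε
  have hε0 : 0 < ε := by positivity
  -- With `u = |x|/r₀`: `κ₀tr₀^d ≤ K₁u`, `Λ = K₂u`, and `h² ≤ r₀²K₃u`. The total loss `e^{-Cu}`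
  -- consists of `e^{-Λ}` and the exponential factor of `δ^d`.
  set C : ℝ := K₂ + d * (2 * K₂ + K₃) with hC
  have hK₁0 : 0 < K₁ := by positivity
  have hK₂0 : 0 < K₂ := by positivity
  have hK₃0 : 0 < K₃ := by positivity
  have hC0 : 0 < C := by positivity
  refine ⟨fourierConst d * (coreHeight d * ballVol d * ε ^ d / v),
    max K₁ (2 / v * Real.exp C), by positivity, by positivity, ?_⟩
  intro ν hν hA r₀ κ₀ hr₀ hκ hs hk P p hP hp t x ht hx
  have hm := secondMoment_pos hν hs
  have hh := hFun_pos hL hν ht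
  set u : ℝ := ‖x‖ / r₀ with hu
  have hxu : ‖x‖ = u * r₀ := by rw [hu, div_mul_cancel₀ _ hr₀.ne']
  have hu1 : 1 ≤ u := (one_le_div hr₀).2 ((le_max_left _ _).trans hx)
  have hu0 : 0 < u := by linarith
  have hxt : η * L₀ * secondMoment ν * t ≤ 4 * r₀ ^ 2 * u := by
    have h1 := (le_max_right _ _).trans hx
    rw [div_mul_eq_mul_div, div_le_iff₀ (by positivity), hxu] at h1
    linarith
  set τ : ℝ := κ₀ * t * r₀ ^ d with hτ
  have hτ0 : 0 < τ := by positivity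
  have hτu : τ ≤ K₁ * u := by
    have h2 := le_secondMoment hd hν hr₀ hκ hs hk
    have h3 : κ₀ * ((r₀ / 8) ^ d * ballVol d) * (r₀ / 2) ^ 2 = κ₀ * r₀ ^ d * v * (r₀ ^ 2 / 4) := by
      rw [hv, div_pow]
      ring
    rw [h3] at h2
    have h4 : η * L₀ * t * (κ₀ * r₀ ^ d * v * (r₀ ^ 2 / 4)) ≤ η * L₀ * t * secondMoment ν := by
      gcongr
    rw [hK₁, div_mul_eq_mul_div, le_div_iff₀ (by positivity)]
    have h5 : (τ * (η * L₀ * v)) * (r₀ ^ 2 / 4) ≤ (16 * u) * (r₀ ^ 2 / 4) := by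
      rw [hτ]
      linarith
    exact le_of_mul_le_mul_right h5 (by positivity)
  set Λ : ℝ := K₂ * u with hΛ
  have hΛ1 : t * (κ₀ * (r₀ ^ d * ballVol d)) ≤ Λ := by
    calc t * (κ₀ * (r₀ ^ d * ballVol d)) = ballVol d * τ := by rw [hτ]; ring
      _ ≤ ballVol d * (K₁ * u) := by gcongr
      _ = Λ := by rw [hΛ, hK₂]; ring
  have hhr : hFun ν t ≤ r₀ * Real.exp (K₃ * u) := by
    refine (pow_le_pow_iff_left₀ hh.le (by positivity) two_ne_zero).1 ?_
    have h6 : η * L₀ * hFun ν t ^ 2 ≤ 8 * r₀ ^ 2 * u := by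
      have := mul_le_mul_of_nonneg_left (hFun_sq_le hL hν hs ht)
        (by positivity : 0 ≤ η * L₀)
      linarith
    have h7 : hFun ν t ^ 2 ≤ r₀ ^ 2 * (K₃ * u) := by
      rw [hK₃, div_mul_eq_mul_div, ← mul_div_assoc, le_div_iff₀ (by positivity)]
      linarith
    have h8 : K₃ * u ≤ Real.exp (K₃ * u) ^ 2 := by
      have h9 := Real.add_one_le_exp (K₃ * u)
      have h10 : 0 < K₃ * u := by positivity
      nlinarith
    rw [mul_pow]
    exact h7.trans (by gcongr)
  -- The factor `e^{-2K₂u}` is that of `coreRadius`; the factor `e^{-K₃u}` compensates `h ≤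
  -- r₀e^{K₃u}`, so that `δ ≤ r₀/8`.
  set δ : ℝ := ε * Real.exp (-((2 * K₂ + K₃) * u)) * hFun ν t with hδ
  have hδ0 : 0 < δ := by positivity
  have hδ1 : δ ≤ r₀ / 8 := by
    have h11 : Real.exp (-((2 * K₂ + K₃) * u)) * Real.exp (K₃ * u) ≤ 1 := by
      rw [← Real.exp_add, Real.exp_le_one_iff]
      nlinarith
    calc δ ≤ 1 / 8 * Real.exp (-((2 * K₂ + K₃) * u)) * (r₀ * Real.exp (K₃ * u)) := by
          rw [hδ]
          gcongr
          exact min_le_right _ _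
      _ = r₀ / 8 * (Real.exp (-((2 * K₂ + K₃) * u)) * Real.exp (K₃ * u)) := by ring
      _ ≤ r₀ / 8 * 1 := by gcongr
      _ = _ := mul_one _
  have hδ2 : δ ≤ coreRadius d M₀ Λ * hFun ν t := by
    rw [hδ, coreRadius]
    refine mul_le_mul_of_nonneg_right ?_ hh.le
    refine mul_le_mul (min_le_left _ _) (Real.exp_le_exp.2 ?_) (Real.exp_pos _).le (by positivity)
    rw [hΛ]
    nlinarith
  obtain ⟨k, hkn⟩ : ∃ k : ℕ, ⌊2 * u⌋₊ = k + 1 := by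
    refine Nat.exists_eq_succ_of_ne_zero (Nat.floor_pos.2 (by linarith)).ne'
  have hn2 : ((k + 1 : ℕ) : ℝ) ≤ 2 * u := by
    rw [← hkn]
    exact Nat.floor_le (by positivity)
  have hn3 : 2 * u < ((k + 1 : ℕ) : ℝ) + 1 := by
    rw [← hkn]
    exact Nat.lt_floor_add_one _
  have hk1 : (1 : ℝ) ≤ k := by
    have h12 : 2 ≤ k + 1 := by
      rw [← hkn]
      exact Nat.le_floor (by push_cast; linarith)
    have h13 : 1 ≤ k := by omega
    exact_mod_cast h13
  -- From `k + 1 = ⌊2u⌋` one gets `u < k/2 + 1`, and this is at most `7/8 + 3k/4` because `k ≥ 1`.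
  have hxk : ‖x‖ ≤ 7 / 8 * r₀ + 3 / 4 * r₀ * k := by
    have hk2 : (7 / 8 + 3 / 4 * (k : ℝ) - u) * r₀ ≥ 0 := by
      push_cast at hn3
      exact mul_nonneg (by linarith) hr₀.le
    rw [hxu]
    linarith
  refine le_trans ?_ (uniform_jumps_bound hd hM hL hν hA hr₀ hκ hk hP hp ht hΛ1 hδ0 hδ1 hδ2 k hxk)
  have hw := exp_neg_log_le_jump_weight (n := k + 1) hu0 (by linarith)
    hn2 hτ0 hv0 hτu hC0.le (le_max_left K₁ (2 / v * Real.exp C)) (le_max_right _ _)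
  set c : ℝ := max K₁ (2 / v * Real.exp C) with hc
  have hlog : c * ‖x‖ / (r₀ ^ (d + 1) * κ₀ * t) = c * u / τ := by
    rw [hxu, hτ, div_eq_div_iff (by positivity) (by positivity)]
    ring
  have h2u : 2 * ‖x‖ / r₀ = 2 * u := by rw [hu]; ring
  rw [hlog, h2u]
  have hδd : δ ^ d = ε ^ d * Real.exp (-(d * ((2 * K₂ + K₃) * u))) * hFun ν t ^ d := by
    rw [hδ, mul_pow, mul_pow, ← Real.exp_nat_mul]
    ring_nf
  have hexpC : Real.exp (-(C * u)) = Real.exp (-Λ) * Real.exp (-(d * ((2 * K₂ + K₃) * u))) := by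
    rw [← Real.exp_add, hΛ, hC]
    ring_nf
  have hrv : (r₀ / 8) ^ d * ballVol d = r₀ ^ d * v := by
    rw [hv, div_pow]
    ring
  rw [hδd, hrv]
  refine le_trans (b := fourierConst d * (coreHeight d * ballVol d * ε ^ d / v) * ((r₀ ^ d)⁻¹ *
    (Real.exp (-(C * u)) * ((τ * v) ^ (k + 1) / (k + 1).factorial)))) (by gcongr) (le_of_eq ?_)
  rw [hexpC, hτ]
  exact jump_weight_algebra (by positivity) hv0.ne' (by positivity) k

end UniformPart

end TruncatedLevy

end

/-! ### Assembly of the four regimes -/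

theorem mainTheorem6 (d : ℕ) (hd : 0 < d) :
    -- the constants `L₀ = L₀(d)` and `θ = θ(d, M₀)` exist,
    (∃ L₀ : ℝ, TruncatedLevy.IsPsiConstant d L₀) ∧
    (∀ M₀ : ℝ, 0 < M₀ → ∃ θ : ℝ, TruncatedLevy.IsThetaConstant d M₀ θ) ∧
    -- and for all such constants the estimates hold with `c_i = c_i(d, M₀)`
    ∀ M₀ L₀ θ : ℝ, 0 < M₀ →
      TruncatedLevy.IsPsiConstant d L₀ → TruncatedLevy.IsThetaConstant d M₀ θ →
      ∃ c₁ c₂ c₃ c₄ : ℝ, 0 < c₁ ∧ 0 < c₂ ∧ 0 < c₃ ∧ 0 < c₄ ∧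
        ∀ ν : Measure (TruncatedLevy.Rd d), TruncatedLevy.IsSymmLevyMeasure ν →
          TruncatedLevy.CondA1 ν M₀ ∞ →
        ∀ r₀ κ₀ : ℝ, 0 < r₀ → 0 < κ₀ →
          ν.support ⊆ Metric.closedBall 0 r₀ →
          ENNReal.ofReal κ₀ = TruncatedLevy.kappa ν r₀ →
          -- the transition densities exist
          (∃ (P : ℝ → Measure (TruncatedLevy.Rd d)) (p : ℝ → TruncatedLevy.Rd d → ℝ),
            TruncatedLevy.IsLevySemigroup ν P ∧ TruncatedLevy.IsTransitionDensity P p) ∧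
          -- and satisfy the four lower bounds
          (∀ (P : ℝ → Measure (TruncatedLevy.Rd d)) (p : ℝ → TruncatedLevy.Rd d → ℝ),
            TruncatedLevy.IsLevySemigroup ν P → TruncatedLevy.IsTransitionDensity P p →
            ∀ (t : ℝ) (x : TruncatedLevy.Rd d), 0 < t →
              (‖x‖ ≤ TruncatedLevy.eta θ L₀ * TruncatedLevy.hFun ν t →
                c₁ * (TruncatedLevy.hFun ν t ^ d)⁻¹ ≤ p t x) ∧
              (TruncatedLevy.eta θ L₀ * TruncatedLevy.hFun ν t ≤ ‖x‖ → ‖x‖ ≤ r₀ →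
                t ≤ TruncatedLevy.tZero ν θ L₀ r₀ →
                ENNReal.ofReal (c₁ * (t * (TruncatedLevy.hFun ν t ^ d)⁻¹)) *
                    ν (Metric.ball x (c₂ * TruncatedLevy.hFun ν t))
                  ≤ ENNReal.ofReal (p t x)) ∧
              (TruncatedLevy.eta θ L₀ * TruncatedLevy.hFun ν t ≤ ‖x‖ →
                ‖x‖ ≤ TruncatedLevy.CStar ν θ L₀ r₀ * t →
                TruncatedLevy.tZero ν θ L₀ r₀ ≤ t →
                c₁ * ((TruncatedLevy.hFun ν t ^ d)⁻¹ *
                    Real.exp (-(c₃ * ‖x‖ ^ 2 / (TruncatedLevy.secondMoment ν * t))))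
                  ≤ p t x) ∧
              (max r₀ (TruncatedLevy.CStar ν θ L₀ r₀ * t) ≤ ‖x‖ →
                c₁ * ((r₀ ^ d)⁻¹ *
                    Real.exp (-(2 * ‖x‖ / r₀ *
                      Real.log (c₄ * ‖x‖ / (r₀ ^ (d + 1) * κ₀ * t)))))
                  ≤ p t x)) ∧
          -- and `h(t)` is comparable with `√t` for large `t`
          (∀ t : ℝ, r₀ ^ 2 / (L₀ * TruncatedLevy.secondMoment ν) < t →
            Real.sqrt (L₀ * TruncatedLevy.secondMoment ν) * Real.sqrt t
                ≤ TruncatedLevy.hFun ν t ∧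
              TruncatedLevy.hFun ν t
                ≤ Real.sqrt (2 * TruncatedLevy.secondMoment ν) * Real.sqrt t) := by
  refine ⟨TruncatedLevy.exists_isPsiConstant hd, fun M₀ hM => ?_, ?_⟩
  · obtain ⟨L₀, hL⟩ := TruncatedLevy.exists_isPsiConstant hd
    exact TruncatedLevy.exists_isThetaConstant hL hM
  intro M₀ L₀ θ hM hL hθ
  obtain ⟨hθ0, a, b, ha, _, hbound⟩ := hθ
  have hL0 := hL.1
  set η := TruncatedLevy.eta θ L₀ with hη
  have hη0 : 0 < η := lt_min hθ0 (lt_min (by positivity) one_pos)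
  have hη1 : η ≤ 1 := (min_le_right _ _).trans (min_le_right _ _)
  have hηθ : η ≤ θ := min_le_left _ _
  obtain ⟨c₁', c₄, hc₁', hc₄, hfar⟩ := TruncatedLevy.exists_far_bound hd hM hL hη0
  set e : ℝ := TruncatedLevy.fourierConst d * Real.exp (-(4 / (η ^ 2 * L₀))) *
    TruncatedLevy.coreHeight d with he
  have he0 : 0 < e := mul_pos (mul_pos (TruncatedLevy.fourierConst_pos d) (Real.exp_pos _))
    (TruncatedLevy.coreHeight_pos d)
  have hcr := TruncatedLevy.coreRadius_pos d hM (4 / (η ^ 2 * L₀))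
  have hrate := TruncatedLevy.chainRate_pos d a η
  have hca : min a (min e c₁') ≤ a := min_le_left _ _
  have hce : min a (min e c₁') ≤ e := (min_le_right _ _).trans (min_le_left _ _)
  have hcc : min a (min e c₁') ≤ c₁' := (min_le_right _ _).trans (min_le_right _ _)
  -- The height `a` from property (ii) serves both the near-diagonal and the Gaussian regime, `e`
  -- the single jump, `c₁'` the far regime.
  refine ⟨min a (min e c₁'), min (η / 2) (TruncatedLevy.coreRadius d M₀ (4 / (η ^ 2 * L₀))),
    5 * TruncatedLevy.chainRate d a η / (η ^ 2 * L₀), c₄, by positivity, by positivity,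
    by positivity, hc₄, ?_⟩
  intro ν hν hA r₀ κ₀ hr₀ hκ hs hk
  refine ⟨hν.isSymLevy.exists_semigroup fun t ht => hA.integrable_exp hν.isSymLevy ht, ?_,
    fun t ht => TruncatedLevy.sqrt_bounds_hFun hL hν hr₀ hs ht⟩
  intro P p hP hp
  -- Property (ii) covers only the open ball of radius `θh`; continuity of `p_s` supplies the
  -- boundary, which matters when `η = θ`.
  have hdiag : ∀ (s : ℝ) (y : TruncatedLevy.Rd d), 0 < s → ‖y‖ ≤ η * TruncatedLevy.hFun ν s →
      a * (TruncatedLevy.hFun ν s ^ d)⁻¹ ≤ p s y := by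
    intro s y hs0 hy
    have hh := TruncatedLevy.hFun_pos hL hν hs0
    exact TruncatedLevy.near_diagonal_bound hL hν hp hs0 hθ0
      (fun z hz => (hbound ν hν hA P p hP hp s z hs0 hz).1) (hy.trans (by gcongr))
  intro t x ht
  have hh := TruncatedLevy.hFun_pos hL hν ht
  refine ⟨fun hx => ?_, fun hx _ _ => ?_, fun hx1 hx2 ht2 => ?_, fun hx => ?_⟩
  · exact le_trans (by gcongr) (hdiag t x ht hx)
  · refine le_trans ?_ (TruncatedLevy.single_jump_bound hL hM hη0 hη1 hν hA hP hp ht hx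
      (min_le_left _ _) (min_le_right _ _))
    gcongr
  · exact le_trans (by gcongr) (TruncatedLevy.gaussian_bound ha hη0 hη1 hL hν hA hr₀ hs hP hp
      hdiag hx1 hx2 ht2)
  · exact le_trans (by gcongr) (hfar ν hν hA r₀ κ₀ hr₀ hκ hs hk P p hP hp t x ht hx)
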